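/- Let $0<\alpha<1$ and $H=\frac{1+\alpha}{2}$, so that $H\in(\frac12,1)$. For $t\ge 0$ let $\psi_t$ be given by one of $$\text{(a)}\ \psi_t=1_{[0,t]},\qquad \text{(b)}\ \psi_t=1_{[0,t]}-1_{[-t,0]},\qquad \text{(c)}\ \psi_t=1_{[-t,t]} .$$ Let $\vartheta^H=(\vartheta^H_t)_{t\ge0}$ be the corresponding continuous centered Gaussian process, with covariance $E\vartheta^H_s\vartheta^H_t$ equal to $$\text{(a)}\ \tfrac12\left(s^{2H}+t^{2H}-|t-s|^{2H}\right)\quad\text{(fractional Brownian motion)},$$ $$\text{(b)}\ (1-H)\left(s^{2H}+t^{2H}-\tfrac12\left((s+t)^{2H}+|t-s|^{2H}\right)\right)\quad\text{(sub-fractional Brownian motion)},$$ $$\text{(c)}\ (s+t)^{2H}-|t-s|^{2H}\quad\text{(the process }\eta^H).$$ Consider particles on $\mathbb R$ that start at time $0$ from the points of a Poisson random measure with Lebesgue intensity and then move, without branching, independently of each other and of the initial positions, each displaced by a standard symmetric $\alpha$-stable Lévy motion (characteristic function $e^{-t|u|^\alpha}$). Let $N_s$ be the empirical measure of the particles at time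 $s$ and, for $T>0$, $$\langle Y_T(1),\varphi\rangle=\frac1{\sqrt T}\left(\int_0^T\langle N_s,\varphi\rangle\,ds-\int_0^T E\langle N_s,\varphi\rangle\,ds\right).$$ In each of the cases (a), (b), (c) there is a constant $K>0$, depending only on $\alpha$ and the case, such that the following holds, where $\hat\varphi(x)=\int_{\mathbb R}e^{ixy}\varphi(y)\,dy$. 1. For all $s,t\ge0$ the integral below converges absolutely, and $$\frac1\pi\int_{\mathbb R}\hat\psi_t(x)\overline{\hat\psi_s(x)}\,\frac{dx}{|x|^\alpha}=K^2\,E\vartheta^H_s\vartheta^H_t .$$ 2. A process $\vartheta$ is a limit of $(\langle Y_T(1),\psi_t\rangle)_{t\ge0}$ as $T\to\infty$, in the sense of weak convergence of finite-dimensional distributions, if and only if it is centered Gaussian with covariance $E\vartheta_t\vartheta_s=\frac1\pi\int_{\mathbb R}\hat\psi_t(x)\overline{\hat\psi_s(x)}|x|^{-\alpha}dx$. In particular $(\langle Y_T(1),\psi_t\rangle)_{t\ge0}$ converges in this sense to $K\vartheta^H$. 3. Every centered Gaussian process $\vartheta$ with this covariance has the same finite-dimensional distributions as $K\vartheta^H$.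 -/

import Mathlib

open MeasureTheory ProbabilityTheory Filter Topology
open scoped NNReal ENNReal

noncomputable section

namespace OccupationLimit

/-! ## The Gaussian processes -/

/-- `X` is a centered Gaussian process indexed by `[0, ∞)` whose covariance function is `R`. -/
structure IsCenteredGaussian {Ω : Type*} [MeasurableSpace Ω] (X : ℝ≥0 → Ω → ℝ)
    (R : ℝ≥0 → ℝ≥0 → ℝ) (P : Measure Ω) : Prop where
  gaussian : IsGaussianProcess X P
  centered : ∀ t, ∫ ω, X t ω ∂P = 0
  covariance : ∀ s t, ∫ ω, X s ω * X t ω ∂P = R s t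

/-- The three families of test functions. -/
inductive Family
  /-- `ψ_t = 1_{[0,t]}` -/
  | positive
  /-- `ψ_t = 1_{[0,t]} - 1_{[-t,0]}` -/
  | antisymmetric
  /-- `ψ_t = 1_{[-t,t]}` -/
  | symmetric

/-- The test functions `ψ_t`, `t ≥ 0`, of each family. -/
def Family.psi : Family → ℝ≥0 → ℝ → ℝ
  | .positive, t => (Set.Icc (0 : ℝ) t).indicator 1
  | .antisymmetric, t => (Set.Icc (0 : ℝ) t).indicator 1 - (Set.Icc (-(t : ℝ)) 0).indicator 1
  | .symmetric, t => (Set.Icc (-(t : ℝ)) t).indicator 1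

/-- Covariance of fractional Brownian motion. -/
def covFBm (H : ℝ) (s t : ℝ≥0) : ℝ :=
  1 / 2 * ((s : ℝ) ^ (2 * H) + (t : ℝ) ^ (2 * H) - |(t : ℝ) - s| ^ (2 * H))

/-- Covariance of sub-fractional Brownian motion. -/
def covSubFBm (H : ℝ) (s t : ℝ≥0) : ℝ :=
  (1 - H) * ((s : ℝ) ^ (2 * H) + (t : ℝ) ^ (2 * H)
    - 1 / 2 * (((s : ℝ) + t) ^ (2 * H) + |(t : ℝ) - s| ^ (2 * H)))

/-- Covariance of the odd part `η^H` of fractional Brownian motion. -/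
def covOddFBm (H : ℝ) (s t : ℝ≥0) : ℝ :=
  ((s : ℝ) + t) ^ (2 * H) - |(t : ℝ) - s| ^ (2 * H)

/-- The covariance function attached to each family of test functions: fractional Brownian
motion, sub-fractional Brownian motion and `η^H` respectively. -/
def Family.cov : Family → ℝ → ℝ≥0 → ℝ≥0 → ℝ
  | .positive => covFBm
  | .antisymmetric => covSubFBm
  | .symmetric => covOddFBm

/-- `X` is the process attached to the family `F` with parameter `H`: a centered Gaussian process
with continuous paths and the covariance of fBm, sub-fBm or `η^H`. -/
structure Family.IsTarget (F : Family) (H : ℝ) {Ω : Type*} [MeasurableSpace Ω]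
    (X : ℝ≥0 → Ω → ℝ) (P : Measure Ω) : Prop where
  gaussian : IsCenteredGaussian X (F.cov H) P
  continuous : ∀ᵐ ω ∂P, Continuous fun t => X t ω

/-! ## Fourier transforms and the limit covariance -/

/-- `φ̂(x) = ∫ e^{ixy} φ(y) dy`. -/
def hat (φ : ℝ → ℝ) (x : ℝ) : ℂ :=
  ∫ y : ℝ, Complex.exp (Complex.I * x * y) * φ y

/-- The function `φ̂(x) * conj (χ̂(x)) / |x|^α`. -/
def spectralIntegrand (α : ℝ) (φ χ : ℝ → ℝ) (x : ℝ) : ℂ :=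
  hat φ x * (starRingEnd ℂ) (hat χ x) * ((1 / |x| ^ α : ℝ) : ℂ)

/-- `(1/π) ∫ φ̂(x) conj (χ̂(x)) |x|^{-α} dx`. -/
def spectralForm (α : ℝ) (φ χ : ℝ → ℝ) : ℂ :=
  (1 / (Real.pi : ℂ)) * ∫ x : ℝ, spectralIntegrand α φ χ x

/-! ## The particle system -/

/-- `ν` is a Poisson random measure on `ℝ` with intensity measure `μ`. -/
structure IsPoissonRandomMeasure {Ω : Type*} [MeasurableSpace Ω] (ν : Ω → Measure ℝ)
    (μ : Measure ℝ) (P : Measure Ω) : Prop where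
  law : ∀ A : Set ℝ, MeasurableSet A → μ A ≠ ∞ →
    P.map (fun ω => ν ω A) = (poissonMeasure (μ A).toNNReal).map (fun n : ℕ => (n : ℝ≥0∞))
  indep : ∀ (n : ℕ) (A : Fin n → Set ℝ), (∀ i, MeasurableSet (A i)) →
    Pairwise (fun i j => Disjoint (A i) (A j)) → iIndepFun (fun i ω => ν ω (A i)) P

/-- `L` is a standard symmetric `α`-stable Lévy motion on `ℝ`, normalized so that
`E exp(iuL_t) = exp(-t|u|^α)`. -/
structure IsStableLevyMotion {Ω : Type*} [MeasurableSpace Ω] (α : ℝ) (L : ℝ≥0 → Ω → ℝ)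
    (P : Measure Ω) : Prop where
  measurable : ∀ t, Measurable (L t)
  start : ∀ᵐ ω ∂P, L 0 ω = 0
  indepIncrements : HasIndepIncrements L P
  charFun_increment : ∀ s t : ℝ≥0, s ≤ t → ∀ u : ℝ,
    charFun (P.map (fun ω => L t ω - L s ω)) u
      = ((Real.exp (-((t : ℝ) - s) * |u| ^ α) : ℝ) : ℂ)
  cadlag : ∀ᵐ ω ∂P, ∀ t : ℝ≥0,
    ContinuousWithinAt (fun r => L r ω) (Set.Ici t) t ∧
      ∃ l : ℝ, Tendsto (fun r => L r ω) (𝓝[<] t) (𝓝 l)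

/-- The particle system without branching: the initial positions `ξ 0, ξ 1, …` enumerate the points
of a Poisson random measure with Lebesgue intensity, and the `i`-th particle sits at `ξ i + L i t`
at time `t`, where the displacements `L i` are independent standard symmetric `α`-stable Lévy
motions, independent of the initial positions. -/
structure IsParticleSystem {Ω : Type*} [MeasurableSpace Ω] (α : ℝ) (ξ : ℕ → Ω → ℝ)
    (L : ℕ → ℝ≥0 → Ω → ℝ) (P : Measure Ω) : Prop where
  measurable_position : ∀ i, Measurable (ξ i)
  poisson : IsPoissonRandomMeasure (fun ω => Measure.sum fun i => Measure.dirac (ξ i ω)) volume P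
  stable : ∀ i, IsStableLevyMotion α (L i) P
  indep_motions : iIndepFun (fun i ω t => L i t ω) P
  indep_positions : IndepFun (fun ω i => ξ i ω) (fun ω i t => L i t ω) P

/-- The empirical measure `N_t = ∑_i δ_{ξ_i + L_i(t)}`. -/
def empirical {Ω : Type*} (ξ : ℕ → Ω → ℝ) (L : ℕ → ℝ≥0 → Ω → ℝ) (t : ℝ≥0) (ω : Ω) : Measure ℝ :=
  Measure.sum fun i => Measure.dirac (ξ i ω + L i t ω)

/-- `⟨N_t, φ⟩`. -/
def pairing {Ω : Type*} (ξ : ℕ → Ω → ℝ) (L : ℕ → ℝ≥0 → Ω → ℝ) (φ : ℝ → ℝ) (t : ℝ≥0) (ω : Ω) : ℝ :=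
  ∫ x, φ x ∂(empirical ξ L t ω)

/-- The rescaled occupation time fluctuation with norming `F_T = √T`:
`⟨Y_T(t), φ⟩ = T^{-1/2} (∫_0^{Tt} ⟨N_s, φ⟩ ds - ∫_0^{Tt} E⟨N_s, φ⟩ ds)`. -/
def fluctuation {Ω : Type*} [MeasurableSpace Ω] (ξ : ℕ → Ω → ℝ) (L : ℕ → ℝ≥0 → Ω → ℝ)
    (P : Measure Ω) (T t : ℝ) (φ : ℝ → ℝ) (ω : Ω) : ℝ :=
  1 / √T * ((∫ s in (0 : ℝ)..(T * t), pairing ξ L φ s.toNNReal ω)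
    - ∫ s in (0 : ℝ)..(T * t), ∫ ω', pairing ξ L φ s.toNNReal ω' ∂P)

/-! ## Finite-dimensional distributions -/

/-- Weak convergence, as `T → ∞`, of the finite-dimensional distributions of the real processes
`Y T` to those of `Z`. -/
def FddTendsto {Ω Ω' : Type*} [MeasurableSpace Ω] [MeasurableSpace Ω'] (Y : ℝ → ℝ≥0 → Ω → ℝ)
    (Z : ℝ≥0 → Ω' → ℝ) (P : Measure Ω) [IsProbabilityMeasure P]
    (Q : Measure Ω') [IsProbabilityMeasure Q] : Prop :=
  ∀ (n : ℕ) (t : Fin n → ℝ≥0),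
    TendstoInDistribution (fun (T : ℝ) ω (i : Fin n) => Y T (t i) ω) atTop
      (fun ω (i : Fin n) => Z (t i) ω) (fun _ => P) Q

/-- The processes `X` and `Z` have the same finite-dimensional distributions. -/
def FddEq {Ω Ω' : Type*} [MeasurableSpace Ω] [MeasurableSpace Ω'] (X : ℝ≥0 → Ω → ℝ)
    (Z : ℝ≥0 → Ω' → ℝ) (P : Measure Ω) (Q : Measure Ω') : Prop :=
  ∀ (n : ℕ) (t : Fin n → ℝ≥0),
    IdentDistrib (fun ω (i : Fin n) => X (t i) ω) (fun ω (i : Fin n) => Z (t i) ω) P Q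

end OccupationLimit

end

/-!
The fluctuation of the occupation time is a compensated sum over the points of a Poisson process.
Marking each initial position with the displacement of its particle gives Poisson points on `ℝ ×
(ℝ≥0 → ℝ)` with intensity Lebesgue measure times the law of the stable motion, and the fluctuation
for a test function `φ` is `∑ G_T - ∫ G_T`, where `G_T(x, p) = T^{-1/2} ∫₀ᵀ φ(x + p_s) ds`
(`IsParticleSystem.fluctuation_ae_eq`). Its characteristic function at `1` is therefore `exp ∫
(e^{i G_T} - 1 - i G_T)` (`IsParticleSystem.integral_exp_tsum`).

The exponent tends to `-σ²/2` with `σ² = π⁻¹ ∫ |φ̂(u)|² |u|^{-α} du`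
(`IsTestFunction.tendsto_cexp_occupation`). For the second moment, the invariance of Lebesgue
measure turns `∫ G_T²` into a time average of the autocorrelation of `φ` at the increments of the
stable motion; by Fourier inversion this is `(2π)⁻¹ ∫ |φ̂(u)|² (T⁻¹ ∫₀ᵀ ∫₀ᵀ e^{-|r-s| |u|^α} dr
ds) du`, and the inner average tends to `2 |u|^{-α}`
(`IsTestFunction.tendsto_integral_occupation_sq`). The third moment is `O(T^{-1/2})`: for `α < 1`
the motion is transient, with an integrable bound for the probability that an increment of length
`r` hits an interval (`lintegral_hitBound_lt_top`), so that three visits to the support of `φ`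
during `[0, T]` have total weight `O(T)` (`HasStableIncrements.lintegral_sojourn_pow_three`).

Applied to linear combinations of the `ψ_t`, this identifies the limits of the characteristic
functions of all finite-dimensional distributions as those of a centered Gaussian process with the
spectral covariance; Lévy's continuity theorem (`fddTendsto_iff`) and the determination of a
Gaussian process by its characteristic functions give both directions of the equivalence. Finally,
the spectral integrands of the three families are combinations of `(1 - cos (b x)) |x|^{-2-α}`,
whose integral is a constant times `|b|^{1+α} = |b|^{2H}` by scaling; this yields the three
covariances (`Family.exists_spectralForm_eq`).

Displacements are only measurable at fixed times, while the occupation functional needs joint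
measurability in time and path. Since the paths are right-continuous almost surely, they may be
replaced by the regularization `rightReg`.
-/

noncomputable section

namespace OccupationLimit

/-! ### Poisson points on the line -/

/-- Two products of complex numbers in the unit disc differ by at most the sum of the differences of
their factors. -/
lemma enorm_prod_sub_prod_le {ι : Type*} (s : Finset ι) (a b : ι → ℂ) (ha : ∀ i, ‖a i‖ ≤ 1)
    (hb : ∀ i, ‖b i‖ ≤ 1) : ‖∏ i ∈ s, a i - ∏ i ∈ s, b i‖ₑ ≤ ∑ i ∈ s, ‖a i - b i‖ₑ := by
  classical
  induction s using Finset.induction_on with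
  | empty => simp
  | insert i s hi ih =>
    rw [Finset.prod_insert hi, Finset.prod_insert hi, Finset.sum_insert hi]
    have hB : ‖∏ j ∈ s, b j‖ₑ ≤ 1 := by
      rw [← ofReal_norm, norm_prod, ENNReal.ofReal_le_one]
      exact Finset.prod_le_one (fun _ _ => norm_nonneg _) fun j _ => hb j
    have hA : ‖a i‖ₑ ≤ 1 := by
      rw [← ofReal_norm, ENNReal.ofReal_le_one]; exact ha i
    calc ‖a i * ∏ j ∈ s, a j - b i * ∏ j ∈ s, b j‖ₑ
        = ‖(a i - b i) * ∏ j ∈ s, b j + a i * (∏ j ∈ s, a j - ∏ j ∈ s, b j)‖ₑ := by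
          congr 1; ring
      _ ≤ ‖(a i - b i) * ∏ j ∈ s, b j‖ₑ + ‖a i * (∏ j ∈ s, a j - ∏ j ∈ s, b j)‖ₑ :=
          enorm_add_le _ _
      _ ≤ ‖a i - b i‖ₑ * 1 + 1 * ∑ j ∈ s, ‖a j - b j‖ₑ := by
          rw [enorm_mul, enorm_mul]; gcongr
      _ = _ := by simp

section Poisson

variable {Ω : Type*} [MeasurableSpace Ω] {P : Measure Ω} [IsProbabilityMeasure P]
  {ξ : ℕ → Ω → ℝ}

omit [MeasurableSpace Ω] in
lemma sum_dirac_apply (ω : Ω) {A : Set ℝ} (hA : MeasurableSet A) :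
    Measure.sum (fun i => Measure.dirac (ξ i ω)) A = ∑' i, A.indicator 1 (ξ i ω) := by
  rw [Measure.sum_apply _ hA]
  simp [Measure.dirac_apply' _ hA]

/-- The mean of the Poisson law. -/
lemma lintegral_natCast_poissonMeasure (r : ℝ≥0) :
    ∫⁻ n : ℕ, (n : ℝ≥0∞) ∂(poissonMeasure r) = r := by
  rw [poissonMeasure, lintegral_sum_measure]
  simp only [lintegral_smul_measure, lintegral_dirac, smul_eq_mul]
  rw [tsum_eq_zero_add' ENNReal.summable]
  have h : ∀ n : ℕ, ENNReal.ofReal (Real.exp (-r) * r ^ (n + 1) / (n + 1).factorial)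
      * ((n + 1 : ℕ) : ℝ≥0∞) = r * ENNReal.ofReal (Real.exp (-r) * r ^ n / n.factorial) := by
    intro n
    rw [← ENNReal.ofReal_natCast, ← ENNReal.ofReal_mul (by positivity),
      ← ENNReal.ofReal_coe_nnreal, ← ENNReal.ofReal_mul (by positivity)]
    congr 1
    rw [Nat.factorial_succ]
    push_cast
    field_simp
    ring
  simp only [h, ENNReal.tsum_mul_left]
  rw [← ENNReal.ofReal_tsum_of_nonneg (fun n => by positivity)
    (hasSum_one_poissonMeasure r).summable, (hasSum_one_poissonMeasure r).tsum_eq]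
  simp

/-- The probability generating function of the Poisson law. -/
lemma integral_pow_poissonMeasure (r : ℝ≥0) (c : ℂ) :
    ∫ n : ℕ, c ^ n ∂(poissonMeasure r) = Complex.exp (r * (c - 1)) := by
  rw [integral_poissonMeasure]
  have h : ∀ n : ℕ, (Real.exp (-r) * r ^ n / n.factorial) • c ^ n
      = Complex.exp (-r) * ((n.factorial : ℂ)⁻¹ • ((r : ℂ) * c) ^ n) := by
    intro n
    rw [Complex.real_smul, smul_eq_mul, mul_pow]
    push_cast
    ring
  have h2 := congrFun (NormedSpace.exp_eq_tsum (𝕂 := ℂ) (𝔸 := ℂ)) ((r : ℂ) * c)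
  simp only [h, tsum_mul_left]
  rw [← h2, ← Complex.exp_eq_exp_ℂ, ← Complex.exp_add]
  congr 1
  ring

lemma measurable_sum_dirac_apply (hξ : ∀ i, Measurable (ξ i)) {A : Set ℝ}
    (hA : MeasurableSet A) :
    Measurable fun ω => Measure.sum (fun i => Measure.dirac (ξ i ω)) A := by
  simp_rw [sum_dirac_apply _ hA]
  exact Measurable.tsum fun i => (measurable_one.indicator hA).comp (hξ i)

omit [IsProbabilityMeasure P] in
/-- The intensity measure of the Poisson points is Lebesgue measure. -/
lemma sum_map_of_isPoisson (hξ : ∀ i, Measurable (ξ i))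
    (h : IsPoissonRandomMeasure (fun ω => Measure.sum fun i => Measure.dirac (ξ i ω)) volume P) :
    Measure.sum (fun i => P.map (ξ i)) = volume := by
  have key : ∀ A : Set ℝ, MeasurableSet A → volume A ≠ ∞ →
      Measure.sum (fun i => P.map (ξ i)) A = volume A := by
    intro A hA hA'
    calc Measure.sum (fun i => P.map (ξ i)) A
        = ∫⁻ ω, Measure.sum (fun i => Measure.dirac (ξ i ω)) A ∂P := by
          simp_rw [sum_dirac_apply _ hA]
          rw [Measure.sum_apply _ hA, lintegral_tsum (f := fun i ω => A.indicator 1 (ξ i ω))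
            (fun i => ((measurable_one.indicator hA).comp (hξ i)).aemeasurable)]
          congr 1 with i
          rw [Measure.map_apply (hξ i) hA, ← lintegral_indicator_one (hξ i hA)]
          rfl
      _ = ∫⁻ x, x ∂(P.map fun ω => Measure.sum (fun i => Measure.dirac (ξ i ω)) A) := by
          rw [lintegral_map (f := fun x => x) measurable_id (measurable_sum_dirac_apply hξ hA)]
      _ = volume A := by
          rw [h.law A hA hA', lintegral_map (f := fun x => x) measurable_id (by fun_prop),
            lintegral_natCast_poissonMeasure, ENNReal.coe_toNNReal hA']
  rw [Measure.ext_iff_of_iUnion_eq_univ (iUnion_spanningSets (volume : Measure ℝ))]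
  intro i
  ext A hA
  rw [Measure.restrict_apply hA, Measure.restrict_apply hA]
  refine key _ (hA.inter (measurableSet_spanningSets _ _)) (ne_of_lt ?_)
  exact (measure_mono Set.inter_subset_right).trans_lt (measure_spanningSets_lt_top _ _)

omit [IsProbabilityMeasure P] in
/-- Campbell's formula. -/
lemma lintegral_tsum_comp_of_isPoisson (hξ : ∀ i, Measurable (ξ i))
    (h : IsPoissonRandomMeasure (fun ω => Measure.sum fun i => Measure.dirac (ξ i ω)) volume P)
    {f : ℝ → ℝ≥0∞} (hf : Measurable f) :
    ∫⁻ ω, ∑' i, f (ξ i ω) ∂P = ∫⁻ x, f x := by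
  rw [← sum_map_of_isPoisson hξ h, lintegral_sum_measure,
    lintegral_tsum (f := fun i ω => f (ξ i ω)) (fun i => (hf.comp (hξ i)).aemeasurable)]
  simp_rw [lintegral_map hf (hξ _)]

/-- The generating functional of the Poisson points, for step functions. -/
lemma tendsto_integral_prod_simpleFunc_of_isPoisson (hξ : ∀ i, Measurable (ξ i))
    (h : IsPoissonRandomMeasure (fun ω => Measure.sum fun i => Measure.dirac (ξ i ω)) volume P)
    (f : SimpleFunc ℝ ℂ) (hf : ∀ x, ‖f x‖ ≤ 1) (hi : Integrable fun x => f x - 1) :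
    Tendsto (fun n : ℕ => ∫ ω, ∏ j ∈ Finset.range n, f (ξ j ω) ∂P) atTop
      (𝓝 (Complex.exp (∫ x, (f x - 1)))) := by
  classical
  set s : Finset ℂ := f.range.erase 1 with hs
  have hA : ∀ c, MeasurableSet (f ⁻¹' {c}) := fun c => f.measurableSet_fiber c
  have hfin : ∀ c, c ≠ 1 → volume (f ⁻¹' {c}) ≠ ∞ := by
    intro c hc
    have h1 := hi.measure_norm_ge_lt_top (ε := ‖c - 1‖) (by simpa [sub_eq_zero] using hc)
    refine ((measure_mono fun x hx => ?_).trans_lt h1).ne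
    simp only [Set.mem_preimage, Set.mem_singleton_iff] at hx
    simp [hx]
  -- `N c` counts the points at which the step function takes the value `c`; almost surely only
  -- finitely many points have `f ≠ 1`, so the finite products stabilize at `∏ c ^ N c`.
  set N : ℂ → Ω → ℝ≥0∞ := fun c ω => Measure.sum (fun i => Measure.dirac (ξ i ω)) (f ⁻¹' {c})
  have hNmeas : ∀ c, Measurable (N c) := fun c => measurable_sum_dirac_apply hξ (hA c)
  let g : ℂ → ℝ≥0∞ → ℂ := fun c x => c ^ ⌊x.toReal⌋₊
  have hg : ∀ c, Measurable (g c) := fun c =>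
    (measurable_from_nat (f := fun n => c ^ n)).comp
      (Nat.measurable_floor.comp ENNReal.measurable_toReal)
  have hNfin : ∀ᵐ ω ∂P, ∀ c ∈ s, N c ω ≠ ∞ := by
    rw [Finset.eventually_all]
    intro c hc
    have hc1 : c ≠ 1 := (Finset.mem_erase.1 hc).1
    refine (ae_lt_top (hNmeas c) ?_).mono fun ω => ne_of_lt
    have h2 := lintegral_tsum_comp_of_isPoisson hξ h
      (f := (f ⁻¹' {c}).indicator 1) (measurable_one.indicator (hA c))
    rw [lintegral_indicator_one (hA c)] at h2
    simp_rw [N, sum_dirac_apply _ (hA c)]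
    rw [h2]
    exact hfin c hc1
  have hlim : ∀ᵐ ω ∂P, Tendsto (fun n : ℕ => ∏ j ∈ Finset.range n, f (ξ j ω)) atTop
      (𝓝 (∏ c ∈ s, g c (N c ω))) := by
    filter_upwards [hNfin] with ω hω
    have hfinset : ∀ c ∈ s, {j | f (ξ j ω) = c}.Finite := by
      intro c hc
      have h3 := hω c hc
      simp only [N, sum_dirac_apply _ (hA c)] at h3
      have h4 := ENNReal.finite_const_le_of_tsum_ne_top h3 one_ne_zero
      refine h4.subset fun j hj => ?_
      simp only [Set.mem_ofPred_eq] at hj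
      simp [hj]
    have hfin2 : {j | f (ξ j ω) ≠ 1}.Finite := by
      refine (Set.Finite.biUnion s.finite_toSet hfinset).subset fun j hj => ?_
      simp only [Set.mem_iUnion, Set.mem_ofPred_eq, exists_prop, exists_eq_right']
      exact Finset.mem_coe.2 (Finset.mem_erase.2 ⟨hj, f.mem_range_self _⟩)
    obtain ⟨m, hm⟩ := hfin2.bddAbove
    have hm' : ∀ j, m + 1 ≤ j → f (ξ j ω) = 1 := by
      intro j hj
      by_contra hne
      have := hm hne
      omega
    have hval : ∏ j ∈ Finset.range (m + 1), f (ξ j ω) = ∏ c ∈ s, g c (N c ω) := by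
      rw [← Finset.prod_fiberwise_of_maps_to (g := fun j => f (ξ j ω)) (t := f.range)
        (fun j _ => f.mem_range_self _), hs, ← Finset.prod_erase f.range (a := 1)]
      · refine Finset.prod_congr rfl fun c hc => ?_
        have hc1 : c ≠ 1 := (Finset.mem_erase.1 hc).1
        have hNc : N c ω = ((Finset.range (m + 1)).filter fun j => f (ξ j ω) = c).card := by
          simp only [N, sum_dirac_apply _ (hA c)]
          rw [tsum_eq_sum (s := Finset.range (m + 1))]
          · rw [Finset.card_filter]
            push_cast
            refine Finset.sum_congr rfl fun j _ => ?_
            simp [Set.indicator_apply]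
          · intro j hj
            rw [Finset.mem_range, not_lt] at hj
            simp [hm' j hj, Ne.symm hc1]
        simp only [g, hNc, ENNReal.toReal_natCast, Nat.floor_natCast]
        rw [← Finset.prod_const]
        exact Finset.prod_congr rfl fun j hj => (Finset.mem_filter.1 hj).2
      · exact Finset.prod_eq_one fun j hj => (Finset.mem_filter.1 hj).2
    rw [← hval]
    refine tendsto_const_nhds.congr' ?_
    filter_upwards [eventually_ge_atTop (m + 1)] with n hn
    refine Finset.prod_subset (Finset.range_mono hn) fun j _ hj => hm' j ?_
    simpa using hj
  -- The counts are independent Poisson variables, so the expectation of the product is a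
  -- product of Poisson generating functions.
  have hE : ∫ ω, ∏ c ∈ s, g c (N c ω) ∂P = Complex.exp (∫ x, (f x - 1)) := by
    have hone : ∀ c ∈ s, ∫ ω, g c (N c ω) ∂P
        = Complex.exp (volume.real (f ⁻¹' {c}) * (c - 1)) := by
      intro c hc
      have hc1 : c ≠ 1 := (Finset.mem_erase.1 hc).1
      rw [← integral_map (φ := N c) (hNmeas c).aemeasurable (hg c).aestronglyMeasurable,
        h.law _ (hA c) (hfin c hc1), integral_map (by fun_prop) (hg c).aestronglyMeasurable]
      simp only [g, ENNReal.toReal_natCast, Nat.floor_natCast]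
      rw [integral_pow_poissonMeasure]
      rfl
    have hind := h.indep s.card (fun i => f ⁻¹' {(s.equivFin.symm i : ℂ)}) (fun i => hA _) (by
      intro i j hij
      refine Disjoint.preimage _ (Set.disjoint_singleton.2 fun h => hij ?_)
      exact s.equivFin.symm.injective (Subtype.ext h))
    have hprod := hind.integral_fun_prod_comp
      (f := fun i => g (s.equivFin.symm i : ℂ)) (fun i => (hNmeas _).aemeasurable)
      (fun i => (hg _).aestronglyMeasurable)
    have h5 : ∀ F : ℂ → ℂ, ∏ c ∈ s, F c = ∏ i : Fin s.card, F (s.equivFin.symm i : ℂ) := by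
      intro F
      rw [← Finset.prod_coe_sort, ← Equiv.prod_comp s.equivFin.symm]
    simp_rw [h5]
    refine hprod.trans ?_
    rw [← h5 (fun c => ∫ ω, g c (N c ω) ∂P), Finset.prod_congr rfl hone, ← Complex.exp_sum]
    congr 1
    have h6 : (fun x => f x - 1) = (f - SimpleFunc.const ℝ (1 : ℂ) : SimpleFunc ℝ ℂ) := by
      ext x; simp
    have h7 : (fun x => f x - 1) = fun x => ∑ c ∈ s, (f ⁻¹' {c}).indicator (fun _ => c - 1) x := by
      ext x
      by_cases hx : f x = 1
      · rw [Finset.sum_eq_zero]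
        · simp [hx]
        · intro c hc
          have hc1 : c ≠ 1 := (Finset.mem_erase.1 hc).1
          simp [hx, Ne.symm hc1]
      · rw [Finset.sum_eq_single (f x)]
        · simp
        · intro c _ hc
          simp [Ne.symm hc]
        · intro hc
          exact absurd (Finset.mem_erase.2 ⟨hx, f.mem_range_self _⟩) hc
    rw [h7, integral_finsetSum]
    · refine Finset.sum_congr rfl fun c _ => ?_
      rw [integral_indicator_const _ (hA c), Complex.real_smul]
    · intro c hc
      exact (integrable_indicator_iff (hA c)).2
        (integrableOn_const (hfin c (Finset.mem_erase.1 hc).1))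
  rw [← hE]
  refine tendsto_integral_of_dominated_convergence (fun _ => 1) (fun n => ?_) (by simp)
    (fun n => ae_of_all _ fun ω => ?_) hlim
  · exact (Finset.measurable_prod _ fun j _ => f.measurable.comp (hξ j)).aestronglyMeasurable
  · rw [norm_prod]
    exact Finset.prod_le_one (fun _ _ => norm_nonneg _) fun j _ => hf _

/-- The generating functional of the Poisson points. The product over the points is written as a
limit of finite products; Campbell's formula makes the finite products Lipschitz in the `L¹` norm
of `h - 1`, so that the formula extends from step functions. -/
lemma tendsto_integral_prod_of_isPoisson (hξ : ∀ i, Measurable (ξ i))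
    (h : IsPoissonRandomMeasure (fun ω => Measure.sum fun i => Measure.dirac (ξ i ω)) volume P)
    {f : ℝ → ℂ} (hfm : Measurable f) (hf : ∀ x, ‖f x‖ ≤ 1) (hi : Integrable fun x => f x - 1) :
    Tendsto (fun n : ℕ => ∫ ω, ∏ j ∈ Finset.range n, f (ξ j ω) ∂P) atTop
      (𝓝 (Complex.exp (∫ x, (f x - 1)))) := by
  have h1 : (1 : ℂ) ∈ Metric.closedBall (0 : ℂ) 1 := by simp
  -- Approximation within the unit disc, equal to `1` off a set of finite measure.
  let q : ℕ → SimpleFunc ℝ ℂ := fun k => SimpleFunc.approxOn f hfm (Metric.closedBall 0 1) 1 h1 k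
  have hq1 : ∀ k x, ‖q k x‖ ≤ 1 := fun k x => by
    simpa using SimpleFunc.approxOn_mem hfm h1 k x
  have hqi : ∀ k, Integrable fun x => q k x - 1 := by
    intro k
    refine (hi.norm.add hi.norm).mono' (by fun_prop) (ae_of_all _ fun x => ?_)
    exact SimpleFunc.norm_approxOn_y₀_le hfm h1 x k
  have hq0 : Tendsto (fun k => ∫⁻ x, ‖q k x - f x‖ₑ) atTop (𝓝 0) :=
    SimpleFunc.tendsto_approxOn_L1_enorm hfm h1
      (ae_of_all _ fun x => subset_closure (by simpa using hf x)) hi.2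
  have hmeas : ∀ (u : ℝ → ℂ), Measurable u → ∀ n : ℕ,
      Measurable fun ω => ∏ j ∈ Finset.range n, u (ξ j ω) := fun u hu n =>
    Finset.measurable_prod _ fun j _ => hu.comp (hξ j)
  have hint : ∀ (u : ℝ → ℂ), Measurable u → (∀ x, ‖u x‖ ≤ 1) → ∀ n : ℕ,
      Integrable (fun ω => ∏ j ∈ Finset.range n, u (ξ j ω)) P := by
    intro u hu hu1 n
    refine Integrable.of_bound (hmeas u hu n).aestronglyMeasurable 1 (ae_of_all _ fun ω => ?_)
    rw [norm_prod]
    exact Finset.prod_le_one (fun _ _ => norm_nonneg _) fun j _ => hu1 _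
  have hlip : ∀ k (n : ℕ), ‖(∫ ω, ∏ j ∈ Finset.range n, f (ξ j ω) ∂P)
      - ∫ ω, ∏ j ∈ Finset.range n, q k (ξ j ω) ∂P‖ₑ ≤ ∫⁻ x, ‖q k x - f x‖ₑ := by
    intro k n
    rw [← integral_sub (hint f hfm hf n) (hint (q k) (q k).measurable (hq1 k) n),
      ← lintegral_tsum_comp_of_isPoisson hξ h (f := fun x => ‖q k x - f x‖ₑ) (by fun_prop)]
    refine (enorm_integral_le_lintegral_enorm _).trans (lintegral_mono fun ω => ?_)
    refine (enorm_prod_sub_prod_le _ _ _ (fun j => hf _) (fun j => hq1 k _)).trans ?_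
    refine le_trans (Finset.sum_le_sum fun j _ => ?_) (ENNReal.sum_le_tsum (Finset.range n))
    rw [← enorm_neg, neg_sub]
  have hunif : TendstoUniformlyOnFilter
      (fun k (n : ℕ) => ∫ ω, ∏ j ∈ Finset.range n, q k (ξ j ω) ∂P)
      (fun n : ℕ => ∫ ω, ∏ j ∈ Finset.range n, f (ξ j ω) ∂P) atTop atTop := by
    intro u hu
    obtain ⟨ε, hε, hεu⟩ := mem_uniformity_edist.1 hu
    filter_upwards [(hq0.eventually (gt_mem_nhds hε)).prod_inl (atTop : Filter ℕ)] with p hp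
    refine hεu ?_
    rw [edist_eq_enorm_sub]
    exact (hlip p.1 p.2).trans_lt hp
  refine hunif.tendsto_of_eventually_tendsto (Eventually.of_forall fun k =>
    tendsto_integral_prod_simpleFunc_of_isPoisson hξ h (q k) (hq1 k) (hqi k)) ?_
  refine (Complex.continuous_exp.tendsto _).comp ?_
  refine tendsto_integral_of_L1 _ hi.1 (Eventually.of_forall hqi) ?_
  simpa using hq0

end Poisson

/-! ### The particles as a Poisson process on position and path space -/

section Marked

variable {Ω : Type*} [MeasurableSpace Ω] {P : Measure Ω} [IsProbabilityMeasure P] {α : ℝ}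

omit [IsProbabilityMeasure P] in
/-- The finite-dimensional distributions of a process with independent increments that starts at
`0` are images of products of increment laws, the image map being summation of the increments. -/
lemma exists_map_restrict_eq_map_pi (I : Finset ℝ≥0) :
    ∃ (t : Fin (I.card + 1) → ℝ≥0) (g : (Fin I.card → ℝ) → (I → ℝ)), Monotone t ∧ Measurable g ∧
      ∀ L : ℝ≥0 → Ω → ℝ, IsStableLevyMotion α L P →
        P.map (fun ω => I.restrict (L · ω)) =
          (Measure.pi fun i : Fin I.card =>
            P.map fun ω => L (t i.succ) ω - L (t i.castSucc) ω).map g := by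
  let t : Fin (I.card + 1) → ℝ≥0 := Fin.cons 0 (I.orderEmbOfFin rfl)
  have ht : Monotone t := by
    intro i j hij
    induction i using Fin.cases with
    | zero => simp [t]
    | succ i =>
      induction j using Fin.cases with
      | zero => simp at hij
      | succ j => simpa [t] using hij
  let g : (Fin I.card → ℝ) → (I → ℝ) := fun x i => ∑ j ≤ (I.orderIsoOfFin rfl).symm i, x j
  have hg : Measurable g := by fun_prop
  refine ⟨t, g, ht, hg, fun L h => ?_⟩
  have hinc : ∀ i : Fin I.card, Measurable fun ω => L (t i.succ) ω - L (t i.castSucc) ω :=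
    fun i => (h.measurable _).sub (h.measurable _)
  have hae : (fun ω => I.restrict (L · ω)) =ᵐ[P]
      g ∘ fun ω i => L (t i.succ) ω - L (t i.castSucc) ω := by
    filter_upwards [h.start] with ω hω
    ext x
    simp only [Finset.restrict, g, Function.comp_apply]
    rw [Fin.sum_Iic_sub _ (fun j => L (t j) ω)]
    simp [t, hω, Finset.orderEmbOfFin]
  rw [Measure.map_congr hae, ← Measure.map_map hg (measurable_pi_lambda _ hinc),
    (h.indepIncrements _ _ ht).map_fun_eq_pi_map fun i => (hinc i).aemeasurable]

/-- The law on path space of a standard symmetric stable Lévy motion is determined by the index,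
because the characteristic functions of its increments are prescribed. -/
lemma IsStableLevyMotion.map_path_eq {L L' : ℝ≥0 → Ω → ℝ} (hL : IsStableLevyMotion α L P)
    (hL' : IsStableLevyMotion α L' P) :
    P.map (fun ω t => L t ω) = P.map (fun ω t => L' t ω) := by
  rw [map_eq_iff_forall_finset_map_restrict_eq
    (measurable_pi_lambda _ hL.measurable).aemeasurable
    (measurable_pi_lambda _ hL'.measurable).aemeasurable]
  intro I
  obtain ⟨t, g, ht, hg, key⟩ := exists_map_restrict_eq_map_pi (P := P) (α := α) I
  rw [key L hL, key L' hL']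
  congr 2
  ext1 i
  have hle := ht (Fin.castSucc_le_succ i)
  have h1 := Measure.isProbabilityMeasure_map (μ := P) ((hL.measurable (t i.succ)).sub
    (hL.measurable (t i.castSucc))).aemeasurable
  have h2 := Measure.isProbabilityMeasure_map (μ := P) ((hL'.measurable (t i.succ)).sub
    (hL'.measurable (t i.castSucc))).aemeasurable
  have h3 : charFun (P.map fun ω => L (t i.succ) ω - L (t i.castSucc) ω)
      = charFun (P.map fun ω => L' (t i.succ) ω - L' (t i.castSucc) ω) := by
    ext u
    rw [hL.charFun_increment _ _ hle, hL'.charFun_increment _ _ hle]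
  exact Measure.ext_of_charFun h3

/-- The law on path space of the displacement of one particle. The path space is the product
`ℝ≥0 → ℝ` with its product `σ`-algebra. -/
def pathLaw (L : ℕ → ℝ≥0 → Ω → ℝ) (P : Measure Ω) : Measure (ℝ≥0 → ℝ) :=
  P.map fun ω t => L 0 t ω

variable {ξ : ℕ → Ω → ℝ} {L : ℕ → ℝ≥0 → Ω → ℝ}

omit [IsProbabilityMeasure P] in
lemma IsParticleSystem.measurable_path (h : IsParticleSystem α ξ L P) (i : ℕ) :
    Measurable fun ω t => L i t ω := measurable_pi_lambda _ (h.stable i).measurable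

omit [IsProbabilityMeasure P] in
lemma IsParticleSystem.measurable_position_path (h : IsParticleSystem α ξ L P) (i : ℕ) :
    Measurable fun ω => (ξ i ω, fun t => L i t ω) :=
  (h.measurable_position i).prodMk (h.measurable_path i)

lemma IsParticleSystem.isProbabilityMeasure_pathLaw (h : IsParticleSystem α ξ L P) :
    IsProbabilityMeasure (pathLaw L P) :=
  Measure.isProbabilityMeasure_map (h.measurable_path 0).aemeasurable

/-- All particles have the same displacement law. -/
lemma IsParticleSystem.map_path (h : IsParticleSystem α ξ L P) (i : ℕ) :
    P.map (fun ω t => L i t ω) = pathLaw L P :=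
  (h.stable i).map_path_eq (h.stable 0)

lemma IsParticleSystem.map_position_path (h : IsParticleSystem α ξ L P) (i : ℕ) :
    P.map (fun ω => (ξ i ω, fun t => L i t ω)) = (P.map (ξ i)).prod (pathLaw L P) := by
  have hind : IndepFun (ξ i) (fun ω t => L i t ω) P :=
    h.indep_positions.comp (measurable_pi_apply i) (measurable_pi_apply i)
  rw [(indepFun_iff_map_prod_eq_prod_map_map (h.measurable_position i).aemeasurable
    (h.measurable_path i).aemeasurable).1 hind, h.map_path i]

/-- Campbell's formula for the particles, marked by their displacements. -/
lemma IsParticleSystem.lintegral_tsum (h : IsParticleSystem α ξ L P)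
    {f : ℝ × (ℝ≥0 → ℝ) → ℝ≥0∞} (hf : Measurable f) :
    ∫⁻ ω, ∑' i, f (ξ i ω, fun t => L i t ω) ∂P = ∫⁻ z, f z ∂(volume.prod (pathLaw L P)) := by
  have := h.isProbabilityMeasure_pathLaw
  rw [MeasureTheory.lintegral_tsum (f := fun i ω => f (ξ i ω, fun t => L i t ω))
    (fun i => (hf.comp (h.measurable_position_path i)).aemeasurable),
    lintegral_prod _ hf.aemeasurable,
    ← sum_map_of_isPoisson h.measurable_position h.poisson, lintegral_sum_measure]
  congr 1 with i
  rw [← lintegral_prod _ hf.aemeasurable, ← h.map_position_path i,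
    lintegral_map hf (h.measurable_position_path i)]

lemma IsParticleSystem.ae_tsum_lt_top (h : IsParticleSystem α ξ L P)
    {f : ℝ × (ℝ≥0 → ℝ) → ℝ≥0∞} (hf : Measurable f)
    (hfi : ∫⁻ z, f z ∂(volume.prod (pathLaw L P)) ≠ ∞) :
    ∀ᵐ ω ∂P, ∑' i, f (ξ i ω, fun t => L i t ω) < ∞ := by
  refine ae_lt_top (Measurable.tsum fun i => hf.comp (h.measurable_position_path i)) ?_
  rwa [h.lintegral_tsum hf]

lemma IsParticleSystem.ae_summable (h : IsParticleSystem α ξ L P)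
    {G : ℝ × (ℝ≥0 → ℝ) → ℝ} (hG : Measurable G)
    (hGi : Integrable G (volume.prod (pathLaw L P))) :
    ∀ᵐ ω ∂P, Summable fun i => G (ξ i ω, fun t => L i t ω) := by
  filter_upwards [h.ae_tsum_lt_top hG.enorm hGi.2.ne] with ω hω
  exact Summable.of_enorm hω.ne

/-- Integrating out the displacements of finitely many particles. -/
lemma IsParticleSystem.integral_prod_range (h : IsParticleSystem α ξ L P)
    {u : ℝ × (ℝ≥0 → ℝ) → ℂ} (hu : Measurable u) (hu1 : ∀ z, ‖u z‖ ≤ 1) (n : ℕ) :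
    ∫ ω, ∏ j ∈ Finset.range n, u (ξ j ω, fun t => L j t ω) ∂P
      = ∫ ω, ∏ j ∈ Finset.range n, ∫ p, u (ξ j ω, p) ∂(pathLaw L P) ∂P := by
  have := h.isProbabilityMeasure_pathLaw
  simp_rw [Finset.prod_range]
  have hX : Measurable fun ω (j : Fin n) => ξ j ω :=
    measurable_pi_lambda _ fun j => h.measurable_position j
  have hY : Measurable fun ω (j : Fin n) t => L j t ω :=
    measurable_pi_lambda _ fun j => h.measurable_path j
  have hind : IndepFun (fun ω (j : Fin n) => ξ j ω) (fun ω (j : Fin n) t => L j t ω) P :=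
    IndepFun.comp (φ := fun (x : ℕ → ℝ) (j : Fin n) => x j)
      (ψ := fun (x : ℕ → ℝ≥0 → ℝ) (j : Fin n) => x j) h.indep_positions (by fun_prop)
      (by fun_prop)
  have hpi : P.map (fun ω (j : Fin n) t => L j t ω) = Measure.pi fun _ => pathLaw L P := by
    rw [(h.indep_motions.precomp (Fin.val_injective (n := n))).map_fun_eq_pi_map
      (f := fun (j : Fin n) ω t => L j t ω) fun j => (h.measurable_path j).aemeasurable]
    congr 1 with j
    rw [h.map_path j]
  have hum : Measurable fun z : (Fin n → ℝ) × (Fin n → ℝ≥0 → ℝ) => ∏ j, u (z.1 j, z.2 j) :=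
    Finset.measurable_prod _ fun j _ => by fun_prop
  have : IsProbabilityMeasure (P.map fun ω (j : Fin n) => ξ j ω) :=
    Measure.isProbabilityMeasure_map hX.aemeasurable
  have hint : Integrable (fun z : (Fin n → ℝ) × (Fin n → ℝ≥0 → ℝ) => ∏ j, u (z.1 j, z.2 j))
      ((P.map fun ω (j : Fin n) => ξ j ω).prod (Measure.pi fun _ => pathLaw L P)) := by
    refine Integrable.of_bound hum.aestronglyMeasurable 1 (ae_of_all _ fun ω => ?_)
    rw [norm_prod]
    exact Finset.prod_le_one (fun _ _ => norm_nonneg _) fun j _ => hu1 _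
  have h1 := integral_map (μ := P) (hX.prodMk hY).aemeasurable
    (f := fun z : (Fin n → ℝ) × (Fin n → ℝ≥0 → ℝ) => ∏ j, u (z.1 j, z.2 j))
    hum.aestronglyMeasurable
  rw [(indepFun_iff_map_prod_eq_prod_map_map hX.aemeasurable hY.aemeasurable).1 hind, hpi,
    integral_prod _ hint] at h1
  rw [← h1]
  have h2 : ∀ x : Fin n → ℝ,
      ∫ y : Fin n → ℝ≥0 → ℝ, ∏ j, u (x j, y j) ∂(Measure.pi fun _ => pathLaw L P)
        = ∏ j, ∫ p, u (x j, p) ∂(pathLaw L P) := fun x =>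
    integral_fintype_prod_eq_prod (fun j p => u (x j, p))
  simp only [h2]
  have hh : Measurable fun x => ∫ p, u (x, p) ∂(pathLaw L P) :=
    hu.stronglyMeasurable.integral_prod_right'.measurable
  rw [integral_map hX.aemeasurable]
  exact (Finset.measurable_prod _ fun j _ => hh.comp (measurable_pi_apply j)).aestronglyMeasurable

/-- The characteristic functional of the marked Poisson points: integrating out the marks reduces it
to the generating functional of the positions. -/
lemma IsParticleSystem.integral_exp_tsum (h : IsParticleSystem α ξ L P)
    {G : ℝ × (ℝ≥0 → ℝ) → ℝ} (hG : Measurable G)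
    (hGi : Integrable G (volume.prod (pathLaw L P))) :
    ∫ ω, Complex.exp (((∑' j, G (ξ j ω, fun t => L j t ω) : ℝ) : ℂ) * Complex.I) ∂P
      = Complex.exp (∫ z, (Complex.exp ((G z : ℂ) * Complex.I) - 1)
          ∂(volume.prod (pathLaw L P))) := by
  have := h.isProbabilityMeasure_pathLaw
  let u : ℝ × (ℝ≥0 → ℝ) → ℂ := fun z => Complex.exp ((G z : ℂ) * Complex.I)
  have hu : Measurable u := by fun_prop
  have hu1 : ∀ z, ‖u z‖ = 1 := fun z => Complex.norm_exp_ofReal_mul_I _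
  let f : ℝ → ℂ := fun x => ∫ p, u (x, p) ∂(pathLaw L P)
  have hf : Measurable f := hu.stronglyMeasurable.integral_prod_right'.measurable
  have hf1 : ∀ x, ‖f x‖ ≤ 1 := fun x => by
    simpa using norm_integral_le_of_norm_le_const (μ := pathLaw L P)
      (ae_of_all _ fun p => (hu1 (x, p)).le)
  have hui : Integrable (fun z => u z - 1) (volume.prod (pathLaw L P)) := by
    refine hGi.norm.mono' (by fun_prop) (ae_of_all _ fun z => ?_)
    simp only [u]
    rw [mul_comm]
    exact Real.norm_exp_I_mul_ofReal_sub_one_le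
  have hfu : ∀ x, f x - 1 = ∫ p, (u (x, p) - 1) ∂(pathLaw L P) := by
    intro x
    rw [integral_sub _ (integrable_const _)]
    · simp [f]
    · exact Integrable.of_bound (hu.comp measurable_prodMk_left).aestronglyMeasurable 1
        (ae_of_all _ fun p => (hu1 (x, p)).le)
  have hfi : Integrable fun x => f x - 1 := by
    simp_rw [hfu]
    exact hui.integral_prod_left
  have hlim := tendsto_integral_prod_of_isPoisson h.measurable_position h.poisson hf hf1 hfi
  simp_rw [hfu] at hlim
  rw [← integral_prod _ hui] at hlim
  simp_rw [f, ← h.integral_prod_range hu (fun z => (hu1 z).le)] at hlim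
  refine tendsto_nhds_unique ?_ hlim
  refine tendsto_integral_of_dominated_convergence (fun _ => 1) (fun n => ?_) (by simp)
    (fun n => ae_of_all _ fun ω => ?_) ?_
  · exact (Finset.measurable_prod _ fun j _ =>
      hu.comp (h.measurable_position_path j)).aestronglyMeasurable
  · rw [norm_prod]
    exact Finset.prod_le_one (fun _ _ => norm_nonneg _) fun j _ => (hu1 _).le
  · filter_upwards [h.ae_summable hG hGi] with ω hs
    simp only [u]
    simp_rw [← Complex.exp_sum, ← Finset.sum_mul, ← Complex.ofReal_sum]
    exact (Complex.continuous_exp.tendsto _).comp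
      (((Complex.continuous_ofReal.tendsto _).comp hs.hasSum.tendsto_sum_nat).mul_const _)

end Marked

/-! ### Integrals involving `|x|^{-α}` and `e^{-a|r|}` -/

/-- A bounded integrable function stays integrable against the weight `|x|^{-α}`, `α < 1`. -/
lemma integrable_mul_one_div_abs_rpow {α : ℝ} (hα0 : 0 < α) (hα1 : α < 1) {f : ℝ → ℝ} {C : ℝ}
    (hf : Integrable f) (hC : ∀ x, |f x| ≤ C) : Integrable fun x => f x * (1 / |x| ^ α) := by
  have hmeas : AEStronglyMeasurable (fun x => f x * (1 / |x| ^ α)) volume :=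
    hf.1.mul (by fun_prop : Measurable fun x : ℝ => 1 / |x| ^ α).aestronglyMeasurable
  rw [← integrableOn_univ, ← Set.union_compl_self (Metric.ball (0 : ℝ) 1), integrableOn_union]
  constructor
  · refine integrableOn_ball_of_norm_le_rpow (C := C) (α := α) (by simp) (by simpa using hα1)
      (ae_of_all _ fun x => ?_) hmeas
    rw [norm_mul, Real.rpow_neg (norm_nonneg _), ← one_div, Real.norm_eq_abs, Real.norm_eq_abs,
      Real.norm_eq_abs, abs_of_nonneg (by positivity : (0 : ℝ) ≤ 1 / |x| ^ α)]
    gcongr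
    exact hC x
  · refine (hf.norm.integrableOn (s := (Metric.ball (0 : ℝ) 1)ᶜ)).mono' hmeas.restrict ?_
    filter_upwards [ae_restrict_mem Metric.isOpen_ball.measurableSet.compl] with x hx
    have hx1 : 1 ≤ |x| := by simpa using hx
    rw [norm_mul]
    refine mul_le_of_le_one_right (norm_nonneg _) ?_
    rw [Real.norm_eq_abs, abs_of_nonneg (by positivity), div_le_one (by positivity)]
    exact Real.one_le_rpow hx1 hα0.le

lemma integral_exp_neg_mul_abs {a : ℝ} (ha : 0 < a) : ∫ r : ℝ, Real.exp (-|r| * a) = 2 / a := by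
  rw [integral_comp_abs (f := fun r => Real.exp (-r * a))]
  have h : ∀ r : ℝ, Real.exp (-r * a) = Real.exp ((-a) * r) := fun r => by ring_nf
  simp_rw [h]
  rw [integral_exp_mul_Ioi (by linarith)]
  simp
  ring

lemma lintegral_exp_neg_mul_abs {a : ℝ} (ha : 0 < a) :
    ∫⁻ r : ℝ, ENNReal.ofReal (Real.exp (-|r| * a)) = ENNReal.ofReal (2 / a) := by
  have h := integral_exp_neg_mul_abs ha
  rw [← h, ofReal_integral_eq_lintegral_ofReal _ (ae_of_all _ fun r => (Real.exp_pos _).le)]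
  exact Integrable.of_integral_ne_zero (by rw [h]; positivity)

/-- Negative moments of order `α < 1` of the standard normal law are finite. -/
lemma lintegral_two_div_abs_rpow_gaussianReal_lt_top {α : ℝ} (hα0 : 0 < α) (hα1 : α < 1) :
    ∫⁻ u, ENNReal.ofReal (2 / |u| ^ α) ∂(gaussianReal 0 1) < ∞ := by
  have h1 : Integrable fun x => 2 * gaussianPDFReal 0 1 x * (1 / |x| ^ α) := by
    refine integrable_mul_one_div_abs_rpow hα0 hα1 (C := 2 * (√(2 * Real.pi * (1 : ℝ≥0)))⁻¹)
      ((integrable_gaussianPDFReal 0 1).const_mul 2) fun x => ?_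
    rw [abs_of_nonneg (mul_nonneg zero_le_two (gaussianPDFReal_nonneg _ _ _)), gaussianPDFReal]
    gcongr
    refine mul_le_of_le_one_right (by positivity) (Real.exp_le_one_iff.2 ?_)
    rw [neg_div]
    exact neg_nonpos.2 (by positivity)
  rw [gaussianReal_of_var_ne_zero 0 one_ne_zero,
    lintegral_withDensity_eq_lintegral_mul _ (measurable_gaussianPDF 0 1) (by fun_prop)]
  refine lt_of_le_of_lt (lintegral_mono fun x => ?_) h1.lintegral_lt_top
  rw [Pi.mul_apply, gaussianPDF, ← ENNReal.ofReal_mul (gaussianPDFReal_nonneg _ _ _)]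
  refine ENNReal.ofReal_le_ofReal (le_of_eq ?_)
  ring

/-! ### A jointly measurable version of the displacement -/

/-- The right-continuous regularization of a path, as an upper limit along the
grid points `(⌊n s⌋ + 1) / n`, which approach `s` from the right. It agrees with right-continuous
paths and, unlike the evaluation map, it is jointly measurable in the path and the time. For paths
that are unbounded along the grid points the upper limit is a junk value. -/
def rightReg (p : ℝ≥0 → ℝ) (s : ℝ≥0) : ℝ :=
  limsup (fun n : ℕ => p ((⌊(n : ℝ≥0) * s⌋₊ + 1) / n)) atTop

lemma measurable_rightReg : Measurable fun z : (ℝ≥0 → ℝ) × ℝ≥0 => rightReg z.1 z.2 := by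
  refine Measurable.limsup fun n => ?_
  have h1 : Measurable fun z : (ℝ≥0 → ℝ) × ℕ => z.1 (((z.2 : ℝ≥0) + 1) / n) :=
    measurable_from_prod_countable_left fun k =>
      (by fun_prop : Measurable fun x : ℝ≥0 → ℝ => x (((k : ℕ) + 1) / n))
  exact h1.comp (measurable_fst.prodMk
    (Nat.measurable_floor.comp (measurable_snd.const_mul (n : ℝ≥0))))

lemma rightReg_eq {p : ℝ≥0 → ℝ} {s : ℝ≥0} (hp : ContinuousWithinAt p (Set.Ici s) s) :
    rightReg p s = p s := by
  refine Tendsto.limsup_eq (hp.tendsto.comp (tendsto_nhdsWithin_iff.2 ⟨?_, ?_⟩))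
  · have h1 : Tendsto (fun n : ℕ => s + 1 / (n : ℝ≥0)) atTop (𝓝 (s + 0)) :=
      tendsto_const_nhds.add tendsto_one_div_atTop_nhds_zero_nat
    rw [add_zero] at h1
    refine tendsto_of_tendsto_of_tendsto_of_le_of_le' tendsto_const_nhds h1 ?_ ?_
    · filter_upwards [eventually_gt_atTop 0] with n hn
      rw [le_div_iff₀ (by positivity), mul_comm]
      exact (Nat.lt_floor_add_one _).le
    · filter_upwards [eventually_gt_atTop 0] with n hn
      rw [add_div]
      gcongr
      rw [div_le_iff₀ (by positivity), mul_comm]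
      exact Nat.floor_le (by positivity)
  · filter_upwards [eventually_gt_atTop 0] with n hn
    rw [Set.mem_Ici, le_div_iff₀ (by positivity), mul_comm]
    exact (Nat.lt_floor_add_one _).le

lemma indepFun_map {Ω S : Type*} [MeasurableSpace Ω] [MeasurableSpace S] {P : Measure Ω}
    {f : Ω → S} {X Y : S → ℝ} (hf : Measurable f) (hX : Measurable X) (hY : Measurable Y)
    (h : IndepFun (X ∘ f) (Y ∘ f) P) : IndepFun X Y (P.map f) := by
  rw [indepFun_iff_measure_inter_preimage_eq_mul] at h ⊢
  intro s t hs ht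
  rw [Measure.map_apply hf ((hX hs).inter (hY ht)), Measure.map_apply hf (hX hs),
    Measure.map_apply hf (hY ht)]
  exact h s t hs ht

/-- A jointly measurable process whose increments over adjacent intervals are independent and
symmetric `α`-stable. -/
structure HasStableIncrements {S : Type*} [MeasurableSpace S] (α : ℝ) (X : ℝ≥0 → S → ℝ)
    (μ : Measure S) : Prop where
  measurable : Measurable fun z : S × ℝ≥0 => X z.2 z.1
  indep : ∀ r s t : ℝ≥0, r ≤ s → s ≤ t →
    IndepFun (fun p => X s p - X r p) (fun p => X t p - X s p) μ
  charFun : ∀ s t : ℝ≥0, s ≤ t → ∀ u : ℝ, charFun (μ.map fun p => X t p - X s p) u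
    = ((Real.exp (-((t : ℝ) - s) * |u| ^ α) : ℝ) : ℂ)

section

variable {Ω : Type*} [MeasurableSpace Ω] {P : Measure Ω} [IsProbabilityMeasure P] {α : ℝ}
  {ξ : ℕ → Ω → ℝ} {L : ℕ → ℝ≥0 → Ω → ℝ}

omit [IsProbabilityMeasure P] in
/-- Almost surely the regularization leaves the displacement of a particle unchanged at all
times. -/
lemma IsParticleSystem.rightReg_ae_eq (h : IsParticleSystem α ξ L P) (i : ℕ) :
    ∀ᵐ ω ∂P, ∀ s, rightReg (fun t => L i t ω) s = L i s ω := by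
  filter_upwards [(h.stable i).cadlag] with ω hω s
  exact rightReg_eq (hω s).1

omit [IsProbabilityMeasure P] in
lemma IsParticleSystem.hasStableIncrements (h : IsParticleSystem α ξ L P) :
    HasStableIncrements α (fun s p => rightReg p s) (pathLaw L P) := by
  have hm : ∀ s, Measurable fun p : ℝ≥0 → ℝ => rightReg p s := fun s =>
    Measurable.comp (f := fun p : ℝ≥0 → ℝ => (p, s)) measurable_rightReg (by fun_prop)
  have hd : ∀ s t, Measurable fun p : ℝ≥0 → ℝ => rightReg p t - rightReg p s := fun s t =>
    (hm t).sub (hm s)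
  have hL := h.measurable_path 0
  have hae : ∀ s t, (fun p : ℝ≥0 → ℝ => rightReg p t - rightReg p s) ∘ (fun ω t => L 0 t ω)
      =ᵐ[P] fun ω => L 0 t ω - L 0 s ω := by
    intro s t
    filter_upwards [h.rightReg_ae_eq 0] with ω hω
    simp [hω]
  refine ⟨measurable_rightReg, fun r s t hrs hst => ?_, fun s t hst u => ?_⟩
  · have h0 : IndepFun (fun ω => L 0 s ω - L 0 r ω) (fun ω => L 0 t ω - L 0 s ω) P :=
      HasIndepIncrements.indepFun_sub_sub (X := L 0) (h.stable 0).indepIncrements hrs hst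
    have h1 := IndepFun.congr h0 (hae r s).symm (hae s t).symm
    rw [pathLaw]
    exact indepFun_map hL (hd r s) (hd s t) h1
  · rw [pathLaw, Measure.map_map (hd _ _) hL, Measure.map_congr (hae s t),
      (h.stable 0).charFun_increment s t hst]

end

/-! ### The stable motion is transient -/

section Green

variable {α : ℝ}

/-- The bound `e^{M²/2} E e^{-r|Z|^α}`, `Z` standard normal, for the probability that an increment
of length `r` of the stable process hits a given interval of length `2M`. -/
def hitBound (α M r : ℝ) : ℝ≥0∞ :=
  ENNReal.ofReal (Real.exp (M ^ 2 / 2)) *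
    ∫⁻ u, ENNReal.ofReal (Real.exp (-r * |u| ^ α)) ∂(gaussianReal 0 1)

lemma measurable_hitBound (α M : ℝ) : Measurable (hitBound α M) := by
  unfold hitBound
  refine Measurable.const_mul (Measurable.lintegral_prod_right' (f := fun z : ℝ × ℝ =>
    ENNReal.ofReal (Real.exp (-z.1 * |z.2| ^ α))) (by fun_prop)) _

/-- The Gaussian kernel `e^{-z²/2}` dominates a multiple of the indicator function of `[-M, M]` and
is the characteristic function of a standard normal variable; so its mean under a law is
the Gaussian mean of the characteristic function of the law. -/
lemma lintegral_indicator_le_hitBound {ν : Measure ℝ} [IsProbabilityMeasure ν] {r : ℝ} (M : ℝ)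
    (hν : ∀ u, charFun ν u = ((Real.exp (-r * |u| ^ α) : ℝ) : ℂ)) (y : ℝ) :
    ∫⁻ d, (Set.Icc (-M) M).indicator 1 (y + d) ∂ν ≤ hitBound α M r := by
  have hgauss : ∀ z : ℝ, ∫ u, Complex.exp (z * u * Complex.I) ∂(gaussianReal 0 1)
      = ((Real.exp (-z ^ 2 / 2) : ℝ) : ℂ) := by
    intro z
    rw [← charFun_apply_real, charFun_gaussianReal]
    push_cast
    congr 1
    simp
    ring
  have hexp : ∀ z : ℝ, ‖Complex.exp (z * Complex.I)‖ = 1 := Complex.norm_exp_ofReal_mul_I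
  have hreal : ((∫ d, Real.exp (-(y + d) ^ 2 / 2) ∂ν : ℝ) : ℂ)
      = ∫ u, Complex.exp (u * y * Complex.I) * charFun ν u ∂(gaussianReal 0 1) := by
    rw [← integral_complex_ofReal]
    simp_rw [← hgauss]
    rw [integral_integral_swap]
    · congr 1 with u
      rw [charFun_apply_real, ← integral_const_mul]
      congr 1 with d
      rw [← Complex.exp_add]
      congr 1
      push_cast
      ring
    · refine Integrable.of_bound (by fun_prop) 1 (ae_of_all _ fun z => ?_)
      have := hexp ((y + z.1) * z.2)
      simp only [Function.uncurry]
      push_cast at this ⊢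
      exact this.le
  have hint : Integrable (fun d => Real.exp (-(y + d) ^ 2 / 2)) ν := by
    refine Integrable.of_bound (by fun_prop) 1 (ae_of_all _ fun d => ?_)
    rw [Real.norm_eq_abs, abs_of_pos (Real.exp_pos _), Real.exp_le_one_iff]
    nlinarith [sq_nonneg (y + d)]
  have hle : ENNReal.ofReal (∫ d, Real.exp (-(y + d) ^ 2 / 2) ∂ν)
      ≤ ∫⁻ u, ENNReal.ofReal (Real.exp (-r * |u| ^ α)) ∂(gaussianReal 0 1) := by
    have h1 : ∫ d, Real.exp (-(y + d) ^ 2 / 2) ∂ν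
        ≤ ‖∫ u, Complex.exp (u * y * Complex.I) * charFun ν u ∂(gaussianReal 0 1)‖ := by
      rw [← hreal, Complex.norm_real]
      exact le_abs_self _
    refine (ENNReal.ofReal_le_ofReal h1).trans ?_
    rw [ofReal_norm]
    refine (enorm_integral_le_lintegral_enorm _).trans (lintegral_mono fun u => ?_)
    rw [enorm_mul, ← ofReal_norm, ← ofReal_norm, hν, Complex.norm_real, Real.norm_eq_abs,
      abs_of_pos (Real.exp_pos _)]
    have := hexp (u * y)
    push_cast at this
    rw [this]
    simp
  calc ∫⁻ d, (Set.Icc (-M) M).indicator 1 (y + d) ∂ν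
      ≤ ∫⁻ d, ENNReal.ofReal (Real.exp (M ^ 2 / 2))
          * ENNReal.ofReal (Real.exp (-(y + d) ^ 2 / 2)) ∂ν := by
        refine lintegral_mono fun d => ?_
        by_cases hd : y + d ∈ Set.Icc (-M) M
        · rw [Set.indicator_of_mem hd, ← ENNReal.ofReal_mul (by positivity), ← Real.exp_add,
            Pi.one_apply, ← ENNReal.ofReal_one]
          refine ENNReal.ofReal_le_ofReal (Real.one_le_exp ?_)
          have := sq_le_sq' hd.1 hd.2
          linarith
        · simp [Set.indicator_of_notMem hd]
    _ = ENNReal.ofReal (Real.exp (M ^ 2 / 2))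
          * ENNReal.ofReal (∫ d, Real.exp (-(y + d) ^ 2 / 2) ∂ν) := by
        rw [lintegral_const_mul _ (by fun_prop), ofReal_integral_eq_lintegral_ofReal hint
          (ae_of_all _ fun d => (Real.exp_pos _).le)]
    _ ≤ hitBound α M r := by
        unfold hitBound
        gcongr

/-- Transience: for `α < 1` the hitting bounds are integrable in time. -/
lemma lintegral_hitBound_lt_top (hα0 : 0 < α) (hα1 : α < 1) (M : ℝ) :
    ∫⁻ r, hitBound α M |r| < ∞ := by
  unfold hitBound
  rw [lintegral_const_mul' _ _ ENNReal.ofReal_ne_top, lintegral_lintegral_swap (by fun_prop)]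
  refine ENNReal.mul_lt_top ENNReal.ofReal_lt_top ?_
  refine lt_of_le_of_lt (le_of_eq (lintegral_congr_ae ?_))
    (lintegral_two_div_abs_rpow_gaussianReal_lt_top hα0 hα1)
  have h0 : ∀ᵐ u ∂(gaussianReal 0 1), u ≠ 0 := by
    have := nullSingletonClass_gaussianReal (μ := 0) (v := 1) one_ne_zero
    rw [ae_iff]
    simp
  filter_upwards [h0] with u hu
  exact lintegral_exp_neg_mul_abs (Real.rpow_pos_of_pos (abs_pos.2 hu) α)

end Green

/-! ### The third moment of the sojourn time in an interval -/

section ThirdMoment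

variable {S : Type*} [MeasurableSpace S] {μ : Measure S} [IsProbabilityMeasure μ] {α : ℝ}
  {X : ℝ≥0 → S → ℝ}

/-- The indicator function of the window `[-M, M]`. -/
def window (M : ℝ) : ℝ → ℝ≥0∞ := (Set.Icc (-M) M).indicator 1

@[fun_prop]
lemma measurable_window (M : ℝ) : Measurable (window M) :=
  measurable_one.indicator measurableSet_Icc

lemma lintegral_window (M : ℝ) : ∫⁻ x, window M x = ENNReal.ofReal (2 * M) := by
  unfold window
  rw [lintegral_indicator_one measurableSet_Icc, Real.volume_Icc]
  congr 1; ring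

omit [IsProbabilityMeasure μ] in
lemma HasStableIncrements.measurable_apply (hX : HasStableIncrements α X μ) (s : ℝ≥0) :
    Measurable (X s) :=
  Measurable.comp (f := fun p => (p, s)) hX.measurable (by fun_prop)

/-- The increment over `[s, t]` hits a translate of the window with probability at most `hitBound`,
uniformly over the translates. -/
lemma HasStableIncrements.lintegral_window_le (hX : HasStableIncrements α X μ) (M : ℝ) {s t : ℝ≥0}
    (hst : s ≤ t) (y : ℝ) :
    ∫⁻ d, window M (y + d) ∂(μ.map fun p => X t p - X s p) ≤ hitBound α M |(t : ℝ) - s| := by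
  have := Measure.isProbabilityMeasure_map (μ := μ)
    ((hX.measurable_apply t).sub (hX.measurable_apply s)).aemeasurable
  rw [abs_of_nonneg (sub_nonneg.2 (NNReal.coe_le_coe.2 hst))]
  exact lintegral_indicator_le_hitBound M (fun u => hX.charFun s t hst u) y

/-- Three visits to the window at increasing times: translation invariance of Lebesgue measure
removes the first displacement, and the two increments are independent. -/
lemma HasStableIncrements.lintegral_three_visits_of_le (hX : HasStableIncrements α X μ) (M : ℝ)
    {r s t : ℝ≥0} (hrs : r ≤ s) (hst : s ≤ t) :
    ∫⁻ p, (∫⁻ x, window M (x + X r p) * window M (x + X s p) * window M (x + X t p)) ∂μ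
      ≤ ENNReal.ofReal (2 * M) *
        (hitBound α M |(s : ℝ) - r| * hitBound α M |(t : ℝ) - s|) := by
  have hr := hX.measurable_apply r
  have hs := hX.measurable_apply s
  have ht := hX.measurable_apply t
  have h1 : ∀ p, ∫⁻ x, window M (x + X r p) * window M (x + X s p) * window M (x + X t p)
      = ∫⁻ x, window M x *
        (window M (x + (X s p - X r p)) * window M (x + (X s p - X r p) + (X t p - X s p))) := by
    intro p
    rw [← lintegral_add_right_eq_self (fun x => window M x *
      (window M (x + (X s p - X r p)) * window M (x + (X s p - X r p) + (X t p - X s p)))) (X r p)]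
    congr 1 with x
    rw [mul_assoc]
    congr 3 <;> ring
  simp_rw [h1]
  rw [lintegral_lintegral_swap (by fun_prop)]
  have h2 : ∀ x, ∫⁻ p, window M x *
        (window M (x + (X s p - X r p)) * window M (x + (X s p - X r p) + (X t p - X s p))) ∂μ
      ≤ window M x * (hitBound α M |(s : ℝ) - r| * hitBound α M |(t : ℝ) - s|) := by
    intro x
    rw [lintegral_const_mul _ (by fun_prop)]
    gcongr
    have h3 := lintegral_map (μ := μ) (f := fun z : ℝ × ℝ => window M (x + z.1) *
      window M (x + z.1 + z.2)) (g := fun p => (X s p - X r p, X t p - X s p)) (by fun_prop)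
      (by fun_prop)
    rw [← h3, (indepFun_iff_map_prod_eq_prod_map_map (by fun_prop) (by fun_prop)).1
      (hX.indep r s t hrs hst), lintegral_prod _ (by fun_prop)]
    calc ∫⁻ d, ∫⁻ e, window M (x + d) * window M (x + d + e) ∂(μ.map fun p => X t p - X s p)
          ∂(μ.map fun p => X s p - X r p)
        ≤ ∫⁻ d, window M (x + d) * hitBound α M |(t : ℝ) - s|
          ∂(μ.map fun p => X s p - X r p) := by
          refine lintegral_mono fun d => ?_
          rw [lintegral_const_mul _ (by fun_prop)]
          gcongr
          exact hX.lintegral_window_le M hst _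
      _ ≤ _ := by
          rw [lintegral_mul_const _ (by fun_prop)]
          gcongr
          exact hX.lintegral_window_le M hrs _
  refine (lintegral_mono h2).trans ?_
  rw [lintegral_mul_const _ (by fun_prop), lintegral_window]

/-- Three visits to the window at arbitrary times. Each summand corresponds to one of the times
being the middle one. -/
lemma HasStableIncrements.lintegral_three_visits (hX : HasStableIncrements α X μ) (M : ℝ)
    (r s t : ℝ≥0) :
    ∫⁻ p, (∫⁻ x, window M (x + X r p) * window M (x + X s p) * window M (x + X t p)) ∂μ
      ≤ ENNReal.ofReal (2 * M) *
        (hitBound α M |(r : ℝ) - s| * hitBound α M |(r : ℝ) - t|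
          + hitBound α M |(r : ℝ) - s| * hitBound α M |(s : ℝ) - t|
          + hitBound α M |(r : ℝ) - t| * hitBound α M |(s : ℝ) - t|) := by
  set k : ℝ≥0 → ℝ≥0 → ℝ≥0∞ := fun a b => hitBound α M |(a : ℝ) - b| with hk
  set V : ℝ≥0 → ℝ≥0 → ℝ≥0 → ℝ≥0∞ := fun r s t =>
    ∫⁻ p, (∫⁻ x, window M (x + X r p) * window M (x + X s p) * window M (x + X t p)) ∂μ with hV
  have kc : ∀ a b, k a b = k b a := fun a b => by simp only [k, abs_sub_comm]
  have V1 : ∀ a b c, V a b c = V b a c := fun a b c => by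
    simp only [V]; congr 1 with p; congr 1 with x; ring
  have V2 : ∀ a b c, V a b c = V a c b := fun a b c => by
    simp only [V]; congr 1 with p; congr 1 with x; ring
  have hle : ∀ a b c, a ≤ b → b ≤ c → V a b c ≤ ENNReal.ofReal (2 * M) * (k b a * k c b) :=
    fun a b c hab hbc => hX.lintegral_three_visits_of_le M hab hbc
  have e1 : k r s * k r t ≤ k r s * k r t + k r s * k s t + k r t * k s t :=
    le_self_add.trans le_self_add
  have e2 : k r s * k s t ≤ k r s * k r t + k r s * k s t + k r t * k s t :=
    le_add_self.trans le_self_add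
  have e3 : k r t * k s t ≤ k r s * k r t + k r s * k s t + k r t * k s t := le_add_self
  change V r s t ≤ ENNReal.ofReal (2 * M) * (k r s * k r t + k r s * k s t + k r t * k s t)
  rcases le_total r s with h1 | h1
  · rcases le_total s t with h2 | h2
    · refine (hle r s t h1 h2).trans ?_
      rw [kc s r, kc t s]; gcongr
    · rcases le_total r t with h3 | h3
      · rw [V2]
        refine (hle r t s h3 h2).trans ?_
        rw [kc t r]; gcongr
      · rw [V2, V1]
        refine (hle t r s h3 h1).trans ?_
        rw [kc s r, mul_comm (k r t)]; gcongr
  · rcases le_total r t with h3 | h3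
    · rw [V1]
      refine (hle s r t h1 h3).trans ?_
      rw [kc t r]; gcongr
    · rcases le_total s t with h2 | h2
      · rw [V1, V2]
        refine (hle s t r h2 h3).trans ?_
        rw [kc t s, mul_comm (k s t)]; gcongr
      · rw [V2, V1, V2]
        refine (hle t s r h2 h1).trans ?_
        rw [mul_comm (k s t)]; gcongr

/-- The time that the trajectory `s ↦ x + X_s` spends in the window up to time `T`. -/
def sojourn (X : ℝ≥0 → S → ℝ) (M T : ℝ) (z : ℝ × S) : ℝ≥0∞ :=
  ∫⁻ s in Set.Ioc 0 T, window M (z.1 + X s.toNNReal z.2)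

omit [IsProbabilityMeasure μ] in
@[fun_prop]
lemma HasStableIncrements.measurable_uncurry_real (hX : HasStableIncrements α X μ) :
    Measurable fun z : (ℝ × S) × ℝ => z.1.1 + X z.2.toNNReal z.1.2 :=
  measurable_fst.fst.add (Measurable.comp (f := fun z : (ℝ × S) × ℝ => (z.1.2, z.2.toNNReal))
    hX.measurable (by fun_prop))

/-- The third moment of the sojourn time, with respect to Lebesgue measure for the
starting point, grows at most linearly. -/
lemma HasStableIncrements.lintegral_sojourn_pow_three (hX : HasStableIncrements α X μ) (M T : ℝ) :
    ∫⁻ z, sojourn X M T z ^ 3 ∂(volume.prod μ)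
      ≤ ENNReal.ofReal (2 * M) * (3 * ENNReal.ofReal T * (∫⁻ r, hitBound α M |r|) ^ 2) := by
  set K := ∫⁻ r, hitBound α M |r| with hK
  set τ : Measure ℝ := volume.restrict (Set.Ioc 0 T) with hτ
  have hm := hX.measurable_uncurry_real
  let w : (ℝ × S) → ℝ → ℝ≥0∞ := fun z s => window M (z.1 + X s.toNNReal z.2)
  have hw : Measurable fun q : (ℝ × S) × ℝ => w q.1 q.2 := (measurable_window M).comp hm
  have hw1 : ∀ z, Measurable (w z) := fun z => hw.comp measurable_prodMk_left
  have hcube : ∀ z, sojourn X M T z ^ 3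
      = ∫⁻ q, w z q.1 * (w z q.2.1 * w z q.2.2) ∂(τ.prod (τ.prod τ)) := by
    intro z
    have hwz := hw1 z
    rw [lintegral_prod_mul (f := w z) (g := fun q : ℝ × ℝ => w z q.1 * w z q.2) hwz.aemeasurable
      (by fun_prop), lintegral_prod_mul hwz.aemeasurable hwz.aemeasurable]
    change (∫⁻ s, w z s ∂τ) ^ 3 = _
    ring
  have hpos : ∀ᵐ q ∂(τ.prod (τ.prod τ)), 0 ≤ q.1 ∧ 0 ≤ q.2.1 ∧ 0 ≤ q.2.2 := by
    simp only [τ, Measure.prod_restrict]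
    filter_upwards [ae_restrict_mem
      (measurableSet_Ioc.prod (measurableSet_Ioc.prod measurableSet_Ioc))] with q hq
    exact ⟨hq.1.1.le, hq.2.1.1.le, hq.2.2.1.le⟩
  let k : ℝ → ℝ → ℝ≥0∞ := fun a b => hitBound α M |a - b|
  have hhb := measurable_hitBound α M
  have hk : Measurable fun q : ℝ × ℝ => k q.1 q.2 := by fun_prop
  have kK : ∀ a, ∫⁻ b, k a b ∂τ ≤ K := fun a =>
    (setLIntegral_le_lintegral _ _).trans
      (lintegral_sub_left_eq_self (fun r => hitBound α M |r|) a).le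
  have kK' : ∀ b, ∫⁻ a, k a b ∂τ ≤ K := fun b => by
    simp only [k, abs_sub_comm _ b]
    exact kK b
  have hvisit : ∀ᵐ q ∂(τ.prod (τ.prod τ)),
      ∫⁻ z, w z q.1 * (w z q.2.1 * w z q.2.2) ∂(volume.prod μ)
        ≤ ENNReal.ofReal (2 * M) * (k q.1 q.2.1 * k q.1 q.2.2 + k q.1 q.2.1 * k q.2.1 q.2.2
          + k q.1 q.2.2 * k q.2.1 q.2.2) := by
    filter_upwards [hpos] with q hq
    have h1 := hX.lintegral_three_visits M q.1.toNNReal q.2.1.toNNReal q.2.2.toNNReal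
    rw [Real.coe_toNNReal _ hq.1, Real.coe_toNNReal _ hq.2.1, Real.coe_toNNReal _ hq.2.2] at h1
    refine le_trans (le_of_eq ?_) h1
    rw [lintegral_prod_symm' _ (by fun_prop)]
    simp only [w, mul_assoc]
  calc ∫⁻ z, sojourn X M T z ^ 3 ∂(volume.prod μ)
      = ∫⁻ q, ∫⁻ z, w z q.1 * (w z q.2.1 * w z q.2.2) ∂(volume.prod μ) ∂(τ.prod (τ.prod τ)) := by
        simp_rw [hcube]
        exact lintegral_lintegral_swap (by fun_prop)
    _ ≤ ∫⁻ q, ENNReal.ofReal (2 * M) * (k q.1 q.2.1 * k q.1 q.2.2 + k q.1 q.2.1 * k q.2.1 q.2.2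
          + k q.1 q.2.2 * k q.2.1 q.2.2) ∂(τ.prod (τ.prod τ)) := lintegral_mono_ae hvisit
    _ ≤ _ := by
        have hT : τ Set.univ = ENNReal.ofReal T := by simp [τ]
        have i1 : ∫⁻ q, k q.1 q.2.1 * k q.1 q.2.2 ∂(τ.prod (τ.prod τ))
            ≤ ENNReal.ofReal T * K ^ 2 := by
          rw [lintegral_prod _ (by fun_prop), ← hT, mul_comm, ← lintegral_const]
          refine lintegral_mono fun r => ?_
          rw [lintegral_prod_mul (f := fun s => k r s) (g := fun t => k r t) (by fun_prop)
            (by fun_prop), sq]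
          exact mul_le_mul' (kK r) (kK r)
        have i2 : ∫⁻ q, k q.1 q.2.1 * k q.2.1 q.2.2 ∂(τ.prod (τ.prod τ))
            ≤ ENNReal.ofReal T * K ^ 2 := by
          rw [lintegral_prod _ (by fun_prop), ← hT, mul_comm, ← lintegral_const]
          refine lintegral_mono fun r => ?_
          rw [lintegral_prod _ (by fun_prop), sq]
          refine le_trans (lintegral_mono fun s => ?_) (?_ : ∫⁻ s, k r s * K ∂τ ≤ K * K)
          · dsimp only
            rw [lintegral_const_mul _ (by fun_prop)]
            exact mul_le_mul_right (kK s) _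
          · rw [lintegral_mul_const _ (by fun_prop)]
            exact mul_le_mul_left (kK r) _
        have i3 : ∫⁻ q, k q.1 q.2.2 * k q.2.1 q.2.2 ∂(τ.prod (τ.prod τ))
            ≤ ENNReal.ofReal T * K ^ 2 := by
          rw [lintegral_prod _ (by fun_prop), ← hT, mul_comm, ← lintegral_const]
          refine lintegral_mono fun r => ?_
          rw [lintegral_prod_symm' _ (by fun_prop), sq]
          refine le_trans (lintegral_mono fun t => ?_) (?_ : ∫⁻ t, k r t * K ∂τ ≤ K * K)
          · dsimp only
            rw [lintegral_const_mul _ (by fun_prop)]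
            exact mul_le_mul_right (kK' t) _
          · rw [lintegral_mul_const _ (by fun_prop)]
            exact mul_le_mul_left (kK r) _
        rw [lintegral_const_mul _ (by fun_prop)]
        gcongr
        rw [lintegral_add_left (by fun_prop), lintegral_add_left (by fun_prop)]
        calc _ ≤ ENNReal.ofReal T * K ^ 2 + ENNReal.ofReal T * K ^ 2 + ENNReal.ofReal T * K ^ 2 :=
              add_le_add (add_le_add i1 i2) i3
          _ = _ := by ring

/-- The mean sojourn time, with respect to Lebesgue measure for the starting point. -/
lemma HasStableIncrements.lintegral_sojourn (hX : HasStableIncrements α X μ) (M T : ℝ) :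
    ∫⁻ z, sojourn X M T z ∂(volume.prod μ) = ENNReal.ofReal T * ENNReal.ofReal (2 * M) := by
  have hm := hX.measurable_uncurry_real
  unfold sojourn
  rw [lintegral_lintegral_swap (f := fun (z : ℝ × S) (s : ℝ) => window M (z.1 + X s.toNNReal z.2))
    ((measurable_window M).comp hm).aemeasurable]
  have h1 : ∀ s : ℝ, ∫⁻ z, window M (z.1 + X s.toNNReal z.2) ∂(volume.prod μ)
      = ENNReal.ofReal (2 * M) := by
    intro s
    have := hX.measurable_apply s.toNNReal
    rw [lintegral_prod_symm' _ (by fun_prop)]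
    simp only [lintegral_add_right_eq_self (window M), lintegral_window, lintegral_const,
      measure_univ, mul_one]
  simp only [h1, lintegral_const, Measure.restrict_apply_univ, Real.volume_Ioc, sub_zero]
  rw [mul_comm]

end ThirdMoment

/-! ### Test functions and their autocorrelation -/

/-- The class of test functions for which the central limit theorem is proved: bounded, with bounded
support, continuous almost everywhere, and with square integrable Fourier transform. -/
structure IsTestFunction (φ : ℝ → ℝ) : Prop where
  measurable : Measurable φ
  bound : ∃ M C : ℝ, 0 ≤ M ∧ 0 ≤ C ∧ ∀ x, |φ x| ≤ (Set.Icc (-M) M).indicator (fun _ => C) x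
  ae_continuousAt : ∀ᵐ x, ContinuousAt φ x
  integrable_hat : Integrable fun u => ‖hat φ u‖ ^ 2

section Fourier

variable {φ : ℝ → ℝ}

lemma hat_neg (φ : ℝ → ℝ) (u : ℝ) : hat φ (-u) = (starRingEnd ℂ) (hat φ u) := by
  unfold hat
  rw [← integral_conj]
  congr 1 with y
  rw [map_mul, ← Complex.exp_conj]
  simp

lemma norm_hat_le (φ : ℝ → ℝ) (u : ℝ) : ‖hat φ u‖ ≤ ∫ x, |φ x| := by
  refine (norm_integral_le_integral_norm _).trans (le_of_eq ?_)
  congr 1 with y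
  rw [norm_mul, Complex.norm_real, Real.norm_eq_abs]
  have := Complex.norm_exp_ofReal_mul_I (u * y)
  rw [show Complex.I * u * y = ((u * y : ℝ) : ℂ) * Complex.I by push_cast; ring, this, one_mul]

lemma measurable_hat (hφ : Measurable φ) : Measurable (hat φ) := by
  unfold hat
  have h : StronglyMeasurable fun z : ℝ × ℝ => Complex.exp (Complex.I * z.1 * z.2) * φ z.2 := by
    apply Measurable.stronglyMeasurable
    fun_prop
  exact h.integral_prod_right'.measurable

lemma fourier_ofReal_eq_hat (φ : ℝ → ℝ) (ξ : ℝ) :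
    FourierTransform.fourier (fun x => (φ x : ℂ)) ξ = hat φ (-(2 * Real.pi * ξ)) := by
  rw [Real.fourier_eq']
  unfold hat
  congr 1 with y
  rw [smul_eq_mul]
  congr 2
  simp
  ring

lemma IsTestFunction.integrable (h : IsTestFunction φ) : Integrable φ := by
  obtain ⟨M, C, hM, hC, hb⟩ := h.bound
  have h1 : Integrable ((Set.Icc (-M) M).indicator fun _ : ℝ => C) :=
    (integrable_indicator_iff measurableSet_Icc).2 (integrableOn_const (by simp))
  exact h1.mono' h.measurable.aestronglyMeasurable (ae_of_all _ fun x => hb x)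

/-- The autocorrelation of a test function has Fourier transform `|φ̂|²`; it is continuous because
`φ` is almost everywhere continuous, and so Fourier inversion holds at every point. -/
lemma IsTestFunction.integral_mul_shift (h : IsTestFunction φ) (y : ℝ) :
    ((∫ x, φ x * φ (x + y) : ℝ) : ℂ)
      = 1 / (2 * Real.pi) * ∫ u : ℝ, Complex.exp (u * y * Complex.I) * (‖hat φ u‖ ^ 2 : ℝ) := by
  obtain ⟨M, C, hM, hC, hb⟩ := h.bound
  have hbC : ∀ x, |φ x| ≤ C := fun x => (hb x).trans (Set.indicator_le_self' (fun _ _ => hC) x)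
  have hφm := h.measurable
  let ρ : ℝ → ℂ := fun y => ((∫ x, φ x * φ (x + y) : ℝ) : ℂ)
  let f : ℝ → ℂ := fun x => (φ (-x) : ℂ)
  let g : ℝ → ℂ := fun x => (φ x : ℂ)
  have hg : Integrable g := h.integrable.ofReal
  have hf : Integrable f := h.integrable.comp_neg.ofReal
  have hρ : convolution f g (ContinuousLinearMap.mul ℂ ℂ) volume = ρ := by
    ext y
    simp only [convolution, ContinuousLinearMap.mul_apply', f, g, ρ]
    rw [← integral_complex_ofReal, ← integral_neg_eq_self]
    congr 1 with x
    simp only [neg_neg, sub_neg_eq_add]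
    push_cast
    rw [add_comm y x]
  have hρi : Integrable ρ := by
    rw [← hρ]
    exact hf.integrable_convolution _ hg
  have hρc : Continuous ρ := by
    refine Complex.continuous_ofReal.comp (continuous_iff_continuousAt.2 fun y => ?_)
    refine continuousAt_of_dominated (bound := fun x => |φ x| * C)
      (Eventually.of_forall fun y => by fun_prop)
      (Eventually.of_forall fun y => ae_of_all _ fun x => ?_) (h.integrable.abs.mul_const C) ?_
    · rw [norm_mul, Real.norm_eq_abs, Real.norm_eq_abs]
      gcongr
      exact hbC _
    · have h1 : ∀ᵐ x, ContinuousAt φ (x + y) :=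
        (quasiMeasurePreserving_add_right volume y).ae h.ae_continuousAt
      filter_upwards [h1] with x hx
      exact continuousAt_const.mul (ContinuousAt.comp (g := φ) hx (by fun_prop))
  have hρF : FourierTransform.fourier ρ = fun ξ => ((‖hat φ (2 * Real.pi * ξ)‖ ^ 2 : ℝ) : ℂ) := by
    ext ξ
    rw [← hρ, Real.fourier_mul_convolution_eq hf hg, fourier_ofReal_eq_hat (fun x => φ (-x)),
      fourier_ofReal_eq_hat, hat_neg φ]
    have h2 : hat (fun x => φ (-x)) (-(2 * Real.pi * ξ)) = hat φ (2 * Real.pi * ξ) := by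
      unfold hat
      rw [← integral_neg_eq_self]
      congr 1 with x
      simp
    rw [h2, Complex.mul_conj, Complex.normSq_eq_norm_sq]
  have hpi : (2 * Real.pi) ≠ 0 := by positivity
  have hFi : Integrable (FourierTransform.fourier ρ) := by
    rw [hρF]
    exact (h.integrable_hat.comp_mul_left' hpi).ofReal
  have hinv := congrFun (hρc.fourierInv_fourier_eq hρi hFi) y
  change ρ y = _
  rw [← hinv, Real.fourierInv_eq', hρF]
  have h3 := Measure.integral_comp_mul_left
    (fun u : ℝ => Complex.exp (u * y * Complex.I) * (‖hat φ u‖ ^ 2 : ℝ)) (2 * Real.pi)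
  have h4 : (1 / (2 * Real.pi) : ℂ) = ((|(2 * Real.pi)⁻¹| : ℝ) : ℂ) := by
    rw [abs_of_pos (by positivity)]
    push_cast
    ring
  rw [h4, ← Complex.real_smul, ← h3]
  congr 1 with ξ
  rw [smul_eq_mul]
  congr 2
  simp
  ring

end Fourier

/-! ### The second moment of the occupation functional -/

section MeanKernel

/-- The mean `T⁻¹ ∫₀ᵀ ∫₀ᵀ e^{-|r-s| a} dr ds` of the exponential covariance. -/
def meanKernel (T a : ℝ) : ℝ :=
  T⁻¹ * ∫ q, Real.exp (-|q.1 - q.2| * a)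
    ∂((volume.restrict (Set.Ioc 0 T)).prod (volume.restrict (Set.Ioc 0 T)))

lemma integral_exp_neg_abs_sub {T a r : ℝ} (ha : 0 < a) (hr : r ∈ Set.Ioc 0 T) :
    ∫ s in Set.Ioc 0 T, Real.exp (-|r - s| * a)
      = (2 - Real.exp (-(a * r)) - Real.exp (-(a * (T - r)))) / a := by
  have hc : Continuous fun s => Real.exp (-|r - s| * a) := by fun_prop
  rw [← intervalIntegral.integral_of_le (hr.1.le.trans hr.2),
    ← intervalIntegral.integral_add_adjacent_intervals (b := r) (hc.intervalIntegrable _ _)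
      (hc.intervalIntegrable _ _)]
  have h1 : ∫ s in (0 : ℝ)..r, Real.exp (-|r - s| * a)
      = ∫ s in (0 : ℝ)..r, Real.exp (a * (s - r)) := by
    refine intervalIntegral.integral_congr fun s hs => ?_
    rw [Set.uIcc_of_le hr.1.le] at hs
    rw [abs_of_nonneg (by linarith [hs.2])]
    ring_nf
  have h2 : ∫ s in r..T, Real.exp (-|r - s| * a) = ∫ s in r..T, Real.exp (-(a * (s - r))) := by
    refine intervalIntegral.integral_congr fun s hs => ?_
    rw [Set.uIcc_of_le hr.2] at hs
    rw [abs_of_nonpos (by linarith [hs.1])]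
    ring_nf
  have d1 : ∀ s : ℝ, HasDerivAt (fun s => Real.exp (a * (s - r)) / a)
      (Real.exp (a * (s - r))) s := by
    intro s
    have := (((hasDerivAt_id s).sub_const r).const_mul a).exp.div_const a
    simpa [ha.ne'] using this
  have d2 : ∀ s : ℝ, HasDerivAt (fun s => -Real.exp (-(a * (s - r))) / a)
      (Real.exp (-(a * (s - r)))) s := by
    intro s
    have := (((hasDerivAt_id s).sub_const r).const_mul a).neg.exp.neg.div_const a
    simpa [ha.ne'] using this
  rw [h1, h2, intervalIntegral.integral_eq_sub_of_hasDerivAt (fun s _ => d1 s)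
      ((by fun_prop : Continuous _).intervalIntegrable _ _),
    intervalIntegral.integral_eq_sub_of_hasDerivAt (fun s _ => d2 s)
      ((by fun_prop : Continuous _).intervalIntegrable _ _)]
  simp
  ring_nf

lemma integrable_exp_neg_abs_sub (T : ℝ) {a : ℝ} (ha : 0 ≤ a) :
    Integrable (fun q : ℝ × ℝ => Real.exp (-|q.1 - q.2| * a))
      ((volume.restrict (Set.Ioc 0 T)).prod (volume.restrict (Set.Ioc 0 T))) := by
  refine Integrable.of_bound (by fun_prop) 1 (ae_of_all _ fun q => ?_)
  rw [Real.norm_eq_abs, abs_of_pos (Real.exp_pos _), Real.exp_le_one_iff]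
  nlinarith [abs_nonneg (q.1 - q.2)]

lemma meanKernel_eq {T a : ℝ} (hT : 0 < T) (ha : 0 < a) :
    meanKernel T a = 2 / a - 2 * (1 - Real.exp (-(a * T))) / a ^ 2 / T := by
  have h1 : ∫ r in Set.Ioc 0 T, ∫ s in Set.Ioc 0 T, Real.exp (-|r - s| * a)
      = ∫ r in Set.Ioc 0 T, (2 - Real.exp (-(a * r)) - Real.exp (-(a * (T - r)))) / a :=
    setIntegral_congr_fun measurableSet_Ioc fun r hr => integral_exp_neg_abs_sub ha hr
  have d : ∀ r : ℝ, HasDerivAt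
      (fun r => (2 * r + Real.exp (-(a * r)) / a - Real.exp (-(a * (T - r))) / a) / a)
      ((2 - Real.exp (-(a * r)) - Real.exp (-(a * (T - r)))) / a) r := by
    intro r
    have e1 := ((hasDerivAt_id r).const_mul a).neg.exp.div_const a
    have e2 := (((hasDerivAt_id r).const_sub T).const_mul a).neg.exp.div_const a
    have := ((((hasDerivAt_id r).const_mul 2).add e1).sub e2).div_const a
    convert! this using 1
    simp [ha.ne']
    field_simp
    ring
  rw [meanKernel, integral_prod _ (integrable_exp_neg_abs_sub T ha.le), h1,
    ← intervalIntegral.integral_of_le hT.le,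
    intervalIntegral.integral_eq_sub_of_hasDerivAt (fun s _ => d s)
      ((by fun_prop : Continuous _).intervalIntegrable _ _)]
  simp
  field_simp
  ring

lemma meanKernel_nonneg {T : ℝ} (hT : 0 < T) (a : ℝ) : 0 ≤ meanKernel T a :=
  mul_nonneg (inv_nonneg.2 hT.le) (integral_nonneg fun _ => (Real.exp_pos _).le)

lemma meanKernel_le {T a : ℝ} (hT : 0 < T) (ha : 0 < a) : meanKernel T a ≤ 2 / a := by
  rw [meanKernel_eq hT ha, sub_le_self_iff]
  have : Real.exp (-(a * T)) ≤ 1 := Real.exp_le_one_iff.2 (by nlinarith)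
  have : 0 ≤ 1 - Real.exp (-(a * T)) := by linarith
  positivity

lemma tendsto_meanKernel {a : ℝ} (ha : 0 < a) :
    Tendsto (fun T => meanKernel T a) atTop (𝓝 (2 / a)) := by
  have h1 : Tendsto (fun T : ℝ => 2 / a - 2 * (1 - Real.exp (-(a * T))) / a ^ 2 / T) atTop
      (𝓝 (2 / a - 0)) := by
    refine tendsto_const_nhds.sub (Tendsto.div_atTop (a := 2 * (1 - 0) / a ^ 2) ?_ tendsto_id)
    refine ((tendsto_const_nhds.sub ?_).const_mul 2).div_const _
    exact Real.tendsto_exp_neg_atTop_nhds_zero.comp (tendsto_id.const_mul_atTop ha)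
  rw [sub_zero] at h1
  refine h1.congr' ?_
  filter_upwards [eventually_gt_atTop 0] with T hT
  rw [meanKernel_eq hT ha]

end MeanKernel

section Occupation

variable {S : Type*} [MeasurableSpace S] {μ : Measure S} [IsProbabilityMeasure μ] {α : ℝ}
  {X : ℝ≥0 → S → ℝ} {φ : ℝ → ℝ}

/-- The normalized occupation functional `T^{-1/2} ∫₀ᵀ φ(x + X_s) ds` of a trajectory, as a function
of the starting point `x` and the element `p` of the sample space of the process `X`. -/
def occupation (X : ℝ≥0 → S → ℝ) (φ : ℝ → ℝ) (T : ℝ) (z : ℝ × S) : ℝ :=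
  1 / √T * ∫ s in Set.Ioc 0 T, φ (z.1 + X s.toNNReal z.2)

omit [IsProbabilityMeasure μ] in
lemma measurable_occupation (hX : HasStableIncrements α X μ) (hφ : Measurable φ) (T : ℝ) :
    Measurable (occupation X φ T) := by
  have h : StronglyMeasurable fun q : (ℝ × S) × ℝ => φ (q.1.1 + X q.2.toNNReal q.1.2) :=
    (hφ.comp hX.measurable_uncurry_real).stronglyMeasurable
  exact (h.integral_prod_right' (ν := volume.restrict (Set.Ioc 0 T))).measurable.const_mul _

lemma enorm_le_mul_window {M C : ℝ}
    (hb : ∀ x, |φ x| ≤ (Set.Icc (-M) M).indicator (fun _ => C) x) (x : ℝ) :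
    ‖φ x‖ₑ ≤ ENNReal.ofReal C * window M x := by
  rw [← ofReal_norm, Real.norm_eq_abs]
  refine (ENNReal.ofReal_le_ofReal (hb x)).trans (le_of_eq ?_)
  by_cases hx : x ∈ Set.Icc (-M) M <;> simp [window, hx]

omit [MeasurableSpace S] in
lemma enorm_occupation_le {M C : ℝ}
    (hb : ∀ x, |φ x| ≤ (Set.Icc (-M) M).indicator (fun _ => C) x) (T : ℝ) (z : ℝ × S) :
    ‖occupation X φ T z‖ₑ ≤ ENNReal.ofReal (1 / √T) * (ENNReal.ofReal C * sojourn X M T z) := by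
  rw [occupation, enorm_mul, Real.enorm_of_nonneg (by positivity), sojourn,
    ← lintegral_const_mul' _ _ ENNReal.ofReal_ne_top]
  gcongr
  exact (enorm_integral_le_lintegral_enorm _).trans
    (lintegral_mono fun s => enorm_le_mul_window hb _)

lemma IsTestFunction.integrable_occupation (h : IsTestFunction φ) (hX : HasStableIncrements α X μ)
    (T : ℝ) : Integrable (occupation X φ T) (volume.prod μ) := by
  obtain ⟨M, C, hM, hC, hb⟩ := h.bound
  refine ⟨(measurable_occupation hX h.measurable T).aestronglyMeasurable, ?_⟩
  refine (lintegral_mono fun z => enorm_occupation_le hb T z).trans_lt ?_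
  rw [lintegral_const_mul' _ _ ENNReal.ofReal_ne_top,
    lintegral_const_mul' _ _ ENNReal.ofReal_ne_top, hX.lintegral_sojourn]
  exact ENNReal.mul_lt_top ENNReal.ofReal_lt_top (ENNReal.mul_lt_top ENNReal.ofReal_lt_top
    (ENNReal.mul_lt_top ENNReal.ofReal_lt_top ENNReal.ofReal_lt_top))

/-- The third absolute moment of the occupation functional decays like `T^{-1/2}`. -/
lemma IsTestFunction.exists_lintegral_occupation_pow_three_le (h : IsTestFunction φ)
    (hX : HasStableIncrements α X μ) (hα0 : 0 < α) (hα1 : α < 1) :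
    ∃ D : ℝ, ∀ T, 0 < T →
      ∫⁻ z, ‖occupation X φ T z‖ₑ ^ 3 ∂(volume.prod μ) ≤ ENNReal.ofReal (D / √T) := by
  obtain ⟨M, C, hM, hC, hb⟩ := h.bound
  set K := ∫⁻ r, hitBound α M |r|
  have hK : K ≠ ∞ := (lintegral_hitBound_lt_top hα0 hα1 M).ne
  refine ⟨C ^ 3 * (2 * M * (3 * K.toReal ^ 2)), fun T hT => ?_⟩
  calc ∫⁻ z, ‖occupation X φ T z‖ₑ ^ 3 ∂(volume.prod μ)
      ≤ ∫⁻ z, (ENNReal.ofReal (1 / √T) * ENNReal.ofReal C) ^ 3 * sojourn X M T z ^ 3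
          ∂(volume.prod μ) := by
        refine lintegral_mono fun z => ?_
        rw [← mul_pow, mul_assoc]
        gcongr
        exact enorm_occupation_le hb T z
    _ ≤ (ENNReal.ofReal (1 / √T) * ENNReal.ofReal C) ^ 3 *
          (ENNReal.ofReal (2 * M) * (3 * ENNReal.ofReal T * K ^ 2)) := by
        rw [lintegral_const_mul' _ _ (by finiteness)]
        gcongr
        exact hX.lintegral_sojourn_pow_three M T
    _ = _ := by
        rw [← ENNReal.ofReal_toReal hK, ← ENNReal.ofReal_pow ENNReal.toReal_nonneg,
          ← ENNReal.ofReal_mul (by positivity), ← ENNReal.ofReal_pow (by positivity),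
          ← ENNReal.ofReal_ofNat 3, ← ENNReal.ofReal_mul (by positivity),
          ← ENNReal.ofReal_mul (by positivity), ← ENNReal.ofReal_mul (by positivity),
          ← ENNReal.ofReal_mul (by positivity)]
        congr 1
        have h2 : √T ^ 2 = T := Real.sq_sqrt hT.le
        have h3 : 0 < √T := Real.sqrt_pos.2 hT
        rw [ENNReal.toReal_ofReal ENNReal.toReal_nonneg]
        field_simp
        rw [h2]
        ring

omit [IsProbabilityMeasure μ] in
lemma HasStableIncrements.integral_cexp_increment (hX : HasStableIncrements α X μ) (r s : ℝ≥0)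
    (u : ℝ) : ∫ p, Complex.exp (u * ((X s p - X r p : ℝ) : ℂ) * Complex.I) ∂μ
      = ((Real.exp (-|(r : ℝ) - s| * |u| ^ α) : ℝ) : ℂ) := by
  have key : ∀ a b : ℝ≥0, a ≤ b → ∀ v : ℝ,
      ∫ p, Complex.exp (v * ((X b p - X a p : ℝ) : ℂ) * Complex.I) ∂μ
        = ((Real.exp (-((b : ℝ) - a) * |v| ^ α) : ℝ) : ℂ) := by
    intro a b hab v
    rw [← hX.charFun a b hab v, charFun_apply_real,
      integral_map (φ := fun p => X b p - X a p)
        ((hX.measurable_apply b).sub (hX.measurable_apply a)).aemeasurable (by fun_prop)]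
  rcases le_total r s with h | h
  · rw [key r s h u, abs_sub_comm, abs_of_nonneg (sub_nonneg.2 (NNReal.coe_le_coe.2 h))]
  · have h1 := key s r h (-u)
    rw [abs_neg] at h1
    rw [abs_of_nonneg (sub_nonneg.2 (NNReal.coe_le_coe.2 h)), ← h1]
    congr 1 with p
    congr 1
    push_cast
    ring

/-- The two-point correlation of the occupation functional, in spectral form. -/
lemma IsTestFunction.integral_mul_eq_spectral (h : IsTestFunction φ)
    (hX : HasStableIncrements α X μ) (r s : ℝ≥0) :
    ∫ p, (∫ x, φ (x + X r p) * φ (x + X s p)) ∂μ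
      = 1 / (2 * Real.pi) * ∫ u : ℝ, ‖hat φ u‖ ^ 2 * Real.exp (-|(r : ℝ) - s| * |u| ^ α) := by
  have hr := hX.measurable_apply r
  have hs := hX.measurable_apply s
  have h1 : ∀ p, ∫ x, φ (x + X r p) * φ (x + X s p) = ∫ x, φ x * φ (x + (X s p - X r p)) := by
    intro p
    rw [← integral_add_right_eq_self (fun x => φ x * φ (x + (X s p - X r p))) (X r p)]
    congr 1 with x
    congr 2
    ring
  simp_rw [h1]
  apply Complex.ofReal_injective
  rw [← integral_complex_ofReal]
  simp_rw [h.integral_mul_shift]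
  rw [integral_const_mul, integral_integral_swap]
  · rw [Complex.ofReal_mul, ← integral_complex_ofReal]
    push_cast
    congr 1
    congr 1 with u
    rw [integral_mul_const]
    have h2 := hX.integral_cexp_increment r s u
    push_cast at h2
    rw [h2, mul_comm]
  · have h3 : Integrable (fun z : S × ℝ => ‖hat φ z.2‖ ^ 2) (μ.prod volume) :=
      h.integrable_hat.comp_snd μ
    have hh := measurable_hat h.measurable
    refine h3.mono' (by fun_prop) (ae_of_all _ fun z => ?_)
    simp only [Function.uncurry]
    rw [norm_mul, Complex.norm_real, Real.norm_eq_abs, abs_of_nonneg (by positivity)]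
    have h4 := Complex.norm_exp_ofReal_mul_I (z.2 * (X s z.1 - X r z.1))
    rw [Complex.ofReal_mul] at h4
    rw [h4, one_mul]

/-- The second moment of the occupation functional, in spectral form. -/
lemma IsTestFunction.integral_occupation_sq (h : IsTestFunction φ)
    (hX : HasStableIncrements α X μ) {T : ℝ} (hT : 0 < T) :
    Integrable (fun z => occupation X φ T z ^ 2) (volume.prod μ) ∧
    ∫ z, occupation X φ T z ^ 2 ∂(volume.prod μ)
      = 1 / (2 * Real.pi) * ∫ u : ℝ, ‖hat φ u‖ ^ 2 * meanKernel T (|u| ^ α) := by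
  obtain ⟨M, C, hM, hC, hb⟩ := h.bound
  set τ : Measure ℝ := volume.restrict (Set.Ioc 0 T) with hτ
  have hφ := h.measurable
  have hXm := hX.measurable_uncurry_real
  have hsq : ∀ z, occupation X φ T z ^ 2 = T⁻¹ *
      ∫ q, φ (z.1 + X q.1.toNNReal z.2) * φ (z.1 + X q.2.toNNReal z.2) ∂(τ.prod τ) := by
    intro z
    rw [integral_prod_mul (fun s : ℝ => φ (z.1 + X s.toNNReal z.2))
      (fun s : ℝ => φ (z.1 + X s.toNNReal z.2)), occupation, mul_pow, div_pow, one_pow,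
      Real.sq_sqrt hT.le, one_div, sq (∫ s in Set.Ioc 0 T, φ (z.1 + X s.toNNReal z.2))]
  have hm : Measurable fun w : (ℝ × S) × (ℝ × ℝ) =>
      φ (w.1.1 + X w.2.1.toNNReal w.1.2) * φ (w.1.1 + X w.2.2.toNNReal w.1.2) :=
    (hφ.comp (Measurable.comp (f := fun w : (ℝ × S) × (ℝ × ℝ) => (w.1, w.2.1)) hXm
      (by fun_prop))).mul (hφ.comp (Measurable.comp
        (f := fun w : (ℝ × S) × (ℝ × ℝ) => (w.1, w.2.2)) hXm (by fun_prop)))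
  have hint : Integrable (fun w : (ℝ × S) × (ℝ × ℝ) =>
      φ (w.1.1 + X w.2.1.toNNReal w.1.2) * φ (w.1.1 + X w.2.2.toNNReal w.1.2))
      ((volume.prod μ).prod (τ.prod τ)) := by
    refine ⟨hm.aestronglyMeasurable, ?_⟩
    rw [hasFiniteIntegral_iff_enorm, lintegral_prod_symm' _ hm.enorm]
    have h1 : ∀ q : ℝ × ℝ, ∫⁻ z : ℝ × S,
        ‖φ (z.1 + X q.1.toNNReal z.2) * φ (z.1 + X q.2.toNNReal z.2)‖ₑ ∂(volume.prod μ)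
          ≤ ENNReal.ofReal C * ENNReal.ofReal C * ENNReal.ofReal (2 * M) := by
      intro q
      have hq := hX.measurable_apply q.1.toNNReal
      calc _ ≤ ∫⁻ z : ℝ × S, ENNReal.ofReal C * ENNReal.ofReal C *
              window M (z.1 + X q.1.toNNReal z.2) ∂(volume.prod μ) := by
            refine lintegral_mono fun z => ?_
            rw [enorm_mul]
            calc _ ≤ (ENNReal.ofReal C * window M (z.1 + X q.1.toNNReal z.2))
                  * (ENNReal.ofReal C * 1) := by
                  gcongr
                  · exact enorm_le_mul_window hb _
                  · refine (enorm_le_mul_window hb _).trans ?_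
                    gcongr
                    exact Set.indicator_le_self' (fun _ _ => zero_le) _
              _ = _ := by ring
        _ = _ := by
            rw [lintegral_const_mul' _ _ (by finiteness), lintegral_prod_symm' _ (by fun_prop)]
            simp only [lintegral_add_right_eq_self (window M), lintegral_window, lintegral_const,
              measure_univ, mul_one]
    refine (lintegral_mono h1).trans_lt ?_
    rw [lintegral_const]
    exact ENNReal.mul_lt_top (by finiteness) (measure_lt_top _ _)
  refine ⟨?_, ?_⟩
  · simp_rw [hsq]
    exact hint.integral_prod_left.const_mul _
  simp_rw [hsq]
  rw [integral_const_mul, integral_integral_swap hint]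
  have hpos : ∀ᵐ q ∂(τ.prod τ), 0 ≤ q.1 ∧ 0 ≤ q.2 := by
    simp only [τ, Measure.prod_restrict]
    filter_upwards [ae_restrict_mem (measurableSet_Ioc.prod measurableSet_Ioc)] with q hq
    exact ⟨hq.1.1.le, hq.2.1.le⟩
  have hinner : ∀ᵐ q ∂(τ.prod τ), ∫ z : ℝ × S,
      φ (z.1 + X q.1.toNNReal z.2) * φ (z.1 + X q.2.toNNReal z.2) ∂(volume.prod μ)
        = 1 / (2 * Real.pi) * ∫ u : ℝ, ‖hat φ u‖ ^ 2 * Real.exp (-|q.1 - q.2| * |u| ^ α) := by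
    filter_upwards [hpos, hint.prod_left_ae] with q hq hqi
    have h1 := h.integral_mul_eq_spectral hX q.1.toNNReal q.2.toNNReal
    rw [Real.coe_toNNReal _ hq.1, Real.coe_toNNReal _ hq.2] at h1
    rw [← h1, integral_prod_symm _ hqi]
  rw [integral_congr_ae hinner, integral_const_mul, integral_integral_swap]
  · simp_rw [integral_const_mul, meanKernel]
    rw [mul_left_comm]
    congr 1
    rw [← integral_const_mul]
    congr 1 with u
    ring
  · have h3 : Integrable (fun z : (ℝ × ℝ) × ℝ => ‖hat φ z.2‖ ^ 2) ((τ.prod τ).prod volume) :=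
      h.integrable_hat.comp_snd _
    have hh := measurable_hat h.measurable
    refine h3.mono' (by fun_prop) (ae_of_all _ fun z => ?_)
    simp only [Function.uncurry]
    rw [norm_mul, norm_pow, norm_norm, Real.norm_eq_abs, abs_of_pos (Real.exp_pos _)]
    refine mul_le_of_le_one_right (by positivity) (Real.exp_le_one_iff.2 ?_)
    rw [neg_mul]
    exact neg_nonpos.2 (by positivity)

/-- The limiting variance `π⁻¹ ∫ |φ̂(u)|² |u|^{-α} du`. -/
def limitVariance (α : ℝ) (φ : ℝ → ℝ) : ℝ :=
  1 / Real.pi * ∫ u : ℝ, ‖hat φ u‖ ^ 2 * (1 / |u| ^ α)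

lemma IsTestFunction.integrable_spectral (h : IsTestFunction φ) (hα0 : 0 < α) (hα1 : α < 1) :
    Integrable fun u => ‖hat φ u‖ ^ 2 * (1 / |u| ^ α) := by
  refine integrable_mul_one_div_abs_rpow hα0 hα1 (C := (∫ x, |φ x|) ^ 2) h.integrable_hat
    fun u => ?_
  rw [abs_of_nonneg (by positivity)]
  gcongr
  exact norm_hat_le φ u

/-- The second moment of the occupation functional tends to the limiting variance, since
`T⁻¹ ∫₀ᵀ ∫₀ᵀ e^{-|r-s||u|^α} dr ds` is bounded by and tends to `2 |u|^{-α}`. -/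
lemma IsTestFunction.tendsto_integral_occupation_sq (h : IsTestFunction φ)
    (hX : HasStableIncrements α X μ) (hα0 : 0 < α) (hα1 : α < 1) :
    Tendsto (fun T => ∫ z, occupation X φ T z ^ 2 ∂(volume.prod μ)) atTop
      (𝓝 (limitVariance α φ)) := by
  have hh := measurable_hat h.measurable
  have h1 : Tendsto (fun T => 1 / (2 * Real.pi) *
      ∫ u : ℝ, ‖hat φ u‖ ^ 2 * meanKernel T (|u| ^ α)) atTop
      (𝓝 (1 / (2 * Real.pi) * ∫ u : ℝ, ‖hat φ u‖ ^ 2 * (2 / |u| ^ α))) := by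
    have hne : ∀ᵐ u : ℝ, u ≠ 0 := by simp [ae_iff]
    refine Tendsto.const_mul _ (tendsto_integral_filter_of_dominated_convergence
      (fun u => 2 * (‖hat φ u‖ ^ 2 * (1 / |u| ^ α))) ?_ ?_
      ((h.integrable_spectral hα0 hα1).const_mul 2) ?_)
    · refine Eventually.of_forall fun T => ?_
      have hk : StronglyMeasurable fun z : ℝ × (ℝ × ℝ) =>
          Real.exp (-|z.2.1 - z.2.2| * |z.1| ^ α) := by
        apply Measurable.stronglyMeasurable
        fun_prop
      exact (hh.norm.pow_const 2).aestronglyMeasurable.mul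
        (hk.integral_prod_right'.const_mul _).aestronglyMeasurable
    · filter_upwards [eventually_gt_atTop 0] with T hT
      filter_upwards [hne] with u hu
      have hu' : 0 < |u| ^ α := Real.rpow_pos_of_pos (abs_pos.2 hu) α
      rw [norm_mul, norm_pow, norm_norm, Real.norm_eq_abs, abs_of_nonneg (meanKernel_nonneg hT _)]
      calc _ ≤ ‖hat φ u‖ ^ 2 * (2 / |u| ^ α) := by
            gcongr
            exact meanKernel_le hT hu'
        _ = _ := by ring
    · filter_upwards [hne] with u hu
      exact (tendsto_meanKernel (Real.rpow_pos_of_pos (abs_pos.2 hu) α)).const_mul _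
  have h2 : limitVariance α φ = 1 / (2 * Real.pi) * ∫ u : ℝ, ‖hat φ u‖ ^ 2 * (2 / |u| ^ α) := by
    have h3 : ∀ u : ℝ, ‖hat φ u‖ ^ 2 * (2 / |u| ^ α) = 2 * (‖hat φ u‖ ^ 2 * (1 / |u| ^ α)) :=
      fun u => by ring
    simp_rw [h3]
    rw [integral_const_mul, limitVariance]
    field_simp
  rw [h2]
  refine h1.congr' ?_
  filter_upwards [eventually_gt_atTop 0] with T hT
  rw [(h.integral_occupation_sq hX hT).2]

end Occupation

/-! ### The compensated Poisson exponent -/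

lemma norm_cexp_mul_I_sub_taylor_le (x : ℝ) :
    ‖Complex.exp (x * Complex.I) - 1 - x * Complex.I + x ^ 2 / 2‖ ≤ 4 * |x| ^ 3 := by
  rcases le_total |x| 1 with hx | hx
  · have h := Complex.norm_exp_sub_sum_le_norm_mul_exp ((x : ℂ) * Complex.I) 3
    have hn : ‖(x : ℂ) * Complex.I‖ = |x| := by simp
    rw [hn] at h
    simp only [Finset.sum_range_succ, Finset.sum_range_zero] at h
    have he : Complex.exp (x * Complex.I) - 1 - x * Complex.I + x ^ 2 / 2
        = Complex.exp (x * Complex.I) - (0 + (x * Complex.I) ^ 0 / (Nat.factorial 0 : ℕ)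
          + (x * Complex.I) ^ 1 / (Nat.factorial 1 : ℕ)
          + (x * Complex.I) ^ 2 / (Nat.factorial 2 : ℕ)) := by
      rw [mul_pow, mul_pow, mul_pow, Complex.I_sq]
      simp [Nat.factorial]
      ring
    rw [he]
    refine h.trans ?_
    rw [mul_comm]
    gcongr
    calc Real.exp |x| ≤ Real.exp 1 := Real.exp_le_exp.2 hx
      _ ≤ 4 := by linarith [Real.exp_one_lt_d9]
  · have h1 := Complex.norm_exp_ofReal_mul_I x
    have h2 : ‖(x : ℂ) ^ 2 / 2‖ = |x| ^ 2 / 2 := by simp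
    calc _ ≤ ‖Complex.exp (x * Complex.I)‖ + ‖(1 : ℂ)‖ + ‖(x : ℂ) * Complex.I‖
          + ‖(x : ℂ) ^ 2 / 2‖ := by
          refine (norm_add_le _ _).trans ?_
          gcongr
          refine (norm_sub_le _ _).trans ?_
          gcongr
          exact norm_sub_le _ _
      _ = 2 + |x| + |x| ^ 2 / 2 := by rw [h1, h2]; simp; ring
      _ ≤ 4 * |x| ^ 3 := by nlinarith [sq_nonneg (|x| - 1), mul_self_nonneg |x|]

section CharFun

variable {S : Type*} [MeasurableSpace S] {μ : Measure S} [IsProbabilityMeasure μ] {α : ℝ}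
  {X : ℝ≥0 → S → ℝ} {φ : ℝ → ℝ}

omit [IsProbabilityMeasure μ] in
lemma IsTestFunction.integrable_path (h : IsTestFunction φ) (hX : HasStableIncrements α X μ)
    (T : ℝ) (z : ℝ × S) :
    IntegrableOn (fun s : ℝ => φ (z.1 + X s.toNNReal z.2)) (Set.Ioc 0 T) := by
  obtain ⟨M, C, hM, hC, hb⟩ := h.bound
  refine Measure.integrableOn_of_bounded (M := C) (by simp)
    (Measurable.aestronglyMeasurable (h.measurable.comp (hX.measurable_uncurry_real.comp
      (measurable_prodMk_left (x := z))))) (ae_of_all _ fun s => ?_)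
  exact (hb _).trans (Set.indicator_le_self' (fun _ _ => hC) _)

/-- The mean of the occupation functional. -/
lemma IsTestFunction.integral_occupation (h : IsTestFunction φ) (hX : HasStableIncrements α X μ)
    {T : ℝ} (hT : 0 < T) :
    ∫ z, occupation X φ T z ∂(volume.prod μ) = √T * ∫ x, φ x := by
  have hm : Measurable fun q : (ℝ × S) × ℝ => φ (q.1.1 + X q.2.toNNReal q.1.2) :=
    h.measurable.comp hX.measurable_uncurry_real
  have hs : ∀ s : ℝ, Measurable (X s.toNNReal) := fun s => hX.measurable_apply _
  have hφe : ∫⁻ x, ‖φ x‖ₑ ≠ ∞ := h.integrable.2.ne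
  have hl : ∀ s : ℝ, ∫⁻ z : ℝ × S, ‖φ (z.1 + X s.toNNReal z.2)‖ₑ ∂(volume.prod μ)
      = ∫⁻ x, ‖φ x‖ₑ := by
    intro s
    have := hs s
    have hφm := h.measurable
    rw [lintegral_prod_symm' _ (by fun_prop)]
    simp only [lintegral_add_right_eq_self (fun x => ‖φ x‖ₑ), lintegral_const, measure_univ,
      mul_one]
  have hint : Integrable (fun q : (ℝ × S) × ℝ => φ (q.1.1 + X q.2.toNNReal q.1.2))
      ((volume.prod μ).prod (volume.restrict (Set.Ioc 0 T))) := by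
    refine ⟨hm.aestronglyMeasurable, ?_⟩
    rw [hasFiniteIntegral_iff_enorm, lintegral_prod_symm' _ hm.enorm]
    simp only [hl, lintegral_const]
    exact ENNReal.mul_lt_top hφe.lt_top (by simp)
  unfold occupation
  rw [integral_const_mul, integral_integral_swap hint]
  have h1 : ∀ s : ℝ, ∫ z : ℝ × S, φ (z.1 + X s.toNNReal z.2) ∂(volume.prod μ) = ∫ x, φ x := by
    intro s
    have := hs s
    have hφm := h.measurable
    have hi : Integrable (fun z : ℝ × S => φ (z.1 + X s.toNNReal z.2)) (volume.prod μ) :=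
      ⟨Measurable.aestronglyMeasurable (by fun_prop), by
        rw [hasFiniteIntegral_iff_enorm, hl]
        exact hφe.lt_top⟩
    rw [integral_prod_symm _ hi]
    simp [integral_add_right_eq_self φ]
  simp only [h1, integral_const, MeasurableSet.univ, measureReal_restrict_apply, Set.univ_inter,
    Real.volume_real_Ioc_of_le hT.le, smul_eq_mul, sub_zero]
  have h3 : 0 < √T := Real.sqrt_pos.2 hT
  rw [← mul_assoc, one_div_mul_eq_div, Real.div_sqrt]

/-- The compensated Poisson exponent of the occupation functional tends to the Gaussian one: the
second moment gives the variance, while the third moment, which bounds the error, vanishes. -/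
lemma IsTestFunction.tendsto_cexp_occupation (h : IsTestFunction φ)
    (hX : HasStableIncrements α X μ) (hα0 : 0 < α) (hα1 : α < 1) :
    Tendsto (fun T : ℝ => Complex.exp (∫ z, (Complex.exp ((occupation X φ T z : ℂ) * Complex.I) - 1)
        ∂(volume.prod μ)) * Complex.exp (-((√T * ∫ x, φ x : ℝ) : ℂ) * Complex.I)) atTop
      (𝓝 (Complex.exp (-(limitVariance α φ : ℂ) / 2))) := by
  obtain ⟨D, hD⟩ := h.exists_lintegral_occupation_pow_three_le hX hα0 hα1
  have hsq := h.tendsto_integral_occupation_sq hX hα0 hα1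
  let r : ℝ → ℝ × S → ℂ := fun T z => Complex.exp ((occupation X φ T z : ℂ) * Complex.I) - 1
    - (occupation X φ T z : ℂ) * Complex.I + (occupation X φ T z : ℂ) ^ 2 / 2
  have hr : Tendsto (fun T => ∫ z, r T z ∂(volume.prod μ)) atTop (𝓝 0) := by
    have hlim : Tendsto (fun T : ℝ => 4 * max (D / √T) 0) atTop (𝓝 0) := by
      have h0 : Tendsto (fun T : ℝ => D / √T) atTop (𝓝 0) :=
        tendsto_const_nhds.div_atTop Real.tendsto_sqrt_atTop
      simpa using (h0.max (tendsto_const_nhds (x := (0 : ℝ)))).const_mul 4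
    refine squeeze_zero_norm' ?_ hlim
    filter_upwards [eventually_gt_atTop 0] with T hT
    refine (norm_integral_le_lintegral_norm _).trans ?_
    refine ENNReal.toReal_le_of_le_ofReal (by positivity) ?_
    calc ∫⁻ z, ENNReal.ofReal ‖r T z‖ ∂(volume.prod μ)
        ≤ ∫⁻ z, ENNReal.ofReal 4 * ‖occupation X φ T z‖ₑ ^ 3 ∂(volume.prod μ) := by
          refine lintegral_mono fun z => ?_
          rw [Real.enorm_eq_ofReal_abs, ← ENNReal.ofReal_pow (abs_nonneg _),
            ← ENNReal.ofReal_mul (by norm_num)]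
          exact ENNReal.ofReal_le_ofReal (norm_cexp_mul_I_sub_taylor_le _)
      _ ≤ ENNReal.ofReal 4 * ENNReal.ofReal (D / √T) := by
          rw [lintegral_const_mul' _ _ ENNReal.ofReal_ne_top]
          gcongr
          exact hD T hT
      _ ≤ ENNReal.ofReal (4 * max (D / √T) 0) := by
          rw [← ENNReal.ofReal_mul (by norm_num)]
          gcongr
          exact le_max_left _ _
  have hlim : Tendsto (fun T => Complex.exp ((∫ z, r T z ∂(volume.prod μ))
      - ((∫ z, occupation X φ T z ^ 2 ∂(volume.prod μ) : ℝ) : ℂ) / 2)) atTop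
      (𝓝 (Complex.exp (0 - (limitVariance α φ : ℂ) / 2))) :=
    (Complex.continuous_exp.tendsto _).comp (hr.sub
      (((Complex.continuous_ofReal.tendsto _).comp hsq).div_const 2))
  rw [zero_sub, ← neg_div] at hlim
  refine hlim.congr' ?_
  filter_upwards [eventually_gt_atTop 0] with T hT
  have hi1 : Integrable (fun z => (occupation X φ T z : ℂ) * Complex.I) (volume.prod μ) :=
    (h.integrable_occupation hX T).ofReal.mul_const _
  have hi2 : Integrable (fun z => (occupation X φ T z : ℂ) ^ 2 / 2) (volume.prod μ) := by
    have := ((h.integral_occupation_sq hX hT).1.ofReal (𝕜 := ℂ)).div_const 2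
    simpa using this
  have hi0 : Integrable (fun z => Complex.exp ((occupation X φ T z : ℂ) * Complex.I) - 1)
      (volume.prod μ) := by
    have hm := measurable_occupation hX h.measurable T
    refine (h.integrable_occupation hX T).mono (Measurable.aestronglyMeasurable (by fun_prop))
      (ae_of_all _ fun z => ?_)
    rw [mul_comm]
    exact Real.norm_exp_I_mul_ofReal_sub_one_le
  have e2 : ∫ z, (occupation X φ T z : ℂ) ^ 2 / 2 ∂(volume.prod μ)
      = ((∫ z, occupation X φ T z ^ 2 ∂(volume.prod μ) : ℝ) : ℂ) / 2 := by
    rw [integral_div, ← integral_complex_ofReal]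
    push_cast
    rfl
  have e1 : ∫ z, (occupation X φ T z : ℂ) * Complex.I ∂(volume.prod μ)
      = ((√T * ∫ x, φ x : ℝ) : ℂ) * Complex.I := by
    rw [integral_mul_const, integral_complex_ofReal, h.integral_occupation hX hT]
  rw [← Complex.exp_add]
  congr 1
  have e0 : ∫ z, r T z ∂(volume.prod μ)
      = ∫ z, (Complex.exp ((occupation X φ T z : ℂ) * Complex.I) - 1) ∂(volume.prod μ)
        - ((√T * ∫ x, φ x : ℝ) : ℂ) * Complex.I
        + ((∫ z, occupation X φ T z ^ 2 ∂(volume.prod μ) : ℝ) : ℂ) / 2 := by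
    rw [← e1, ← e2, ← integral_sub hi0 hi1, ← integral_add
      (f := fun z => Complex.exp ((occupation X φ T z : ℂ) * Complex.I) - 1
        - (occupation X φ T z : ℂ) * Complex.I) (hi0.sub hi1) hi2]
  rw [e0]
  ring

end CharFun

/-! ### The fluctuation as a compensated sum over the particles -/

section Fluctuation

variable {Ω : Type*} [MeasurableSpace Ω] {P : Measure Ω} [IsProbabilityMeasure P] {α : ℝ}
  {ξ : ℕ → Ω → ℝ} {L : ℕ → ℝ≥0 → Ω → ℝ} {φ : ℝ → ℝ}

/-- The intensity measure of the marked points. -/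
lemma IsParticleSystem.sum_map_position_path (h : IsParticleSystem α ξ L P) :
    Measure.sum (fun i => P.map fun ω => (ξ i ω, fun t => L i t ω))
      = volume.prod (pathLaw L P) := by
  ext A hA
  have h1 := h.lintegral_tsum (measurable_one.indicator hA)
  rw [lintegral_indicator_one hA] at h1
  rw [← h1, Measure.sum_apply _ hA, MeasureTheory.lintegral_tsum
    (f := fun i ω => A.indicator 1 (ξ i ω, fun t => L i t ω))
    (fun i => ((measurable_one.indicator hA).comp (h.measurable_position_path i)).aemeasurable)]
  congr 1 with i
  rw [Measure.map_apply (h.measurable_position_path i) hA,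
    ← lintegral_indicator_one (h.measurable_position_path i hA)]
  rfl

/-- Campbell's formula for real functionals. -/
lemma IsParticleSystem.integral_tsum (h : IsParticleSystem α ξ L P)
    {G : ℝ × (ℝ≥0 → ℝ) → ℝ} (hG : Measurable G)
    (hGi : Integrable G (volume.prod (pathLaw L P))) :
    ∫ ω, ∑' i, G (ξ i ω, fun t => L i t ω) ∂P = ∫ z, G z ∂(volume.prod (pathLaw L P)) := by
  have hm : ∀ i, Measurable fun ω => G (ξ i ω, fun t => L i t ω) := fun i =>
    hG.comp (h.measurable_position_path i)
  rw [MeasureTheory.integral_tsum (fun i => (hm i).aestronglyMeasurable),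
    ← h.sum_map_position_path, integral_sum_measure]
  · congr 1 with i
    rw [integral_map (h.measurable_position_path i).aemeasurable hG.aestronglyMeasurable]
  · rwa [h.sum_map_position_path]
  · rw [← MeasureTheory.lintegral_tsum (fun i => (hm i).enorm.aemeasurable),
      h.lintegral_tsum hG.enorm]
    exact hGi.2.ne

omit [MeasurableSpace Ω] in
/-- No summability is needed: otherwise both sides are `0`. -/
lemma pairing_eq_tsum (s : ℝ≥0) (ω : Ω) :
    pairing ξ L φ s ω = ∑' i, φ (ξ i ω + L i s ω) := by
  have h1 := integral_sum_dirac (f := φ) (x := fun i => ξ i ω + L i s ω)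
    (c := fun _ : ℕ => (1 : ℝ≥0∞)) (fun _ => ENNReal.one_ne_top)
  simpa [pairing, empirical] using h1

/-- Lebesgue measure is invariant under the particle motion. -/
lemma IsParticleSystem.integral_pairing (h : IsParticleSystem α ξ L P) (hφ : IsTestFunction φ)
    (s : ℝ≥0) : ∫ ω, pairing ξ L φ s ω ∂P = ∫ x, φ x := by
  have := h.isProbabilityMeasure_pathLaw
  have hφm := hφ.measurable
  have hm : Measurable fun z : ℝ × (ℝ≥0 → ℝ) => φ (z.1 + z.2 s) := by fun_prop
  have hi : Integrable (fun z : ℝ × (ℝ≥0 → ℝ) => φ (z.1 + z.2 s))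
      (volume.prod (pathLaw L P)) := by
    refine ⟨hm.aestronglyMeasurable, ?_⟩
    rw [hasFiniteIntegral_iff_enorm, lintegral_prod_symm' _ hm.enorm]
    simp only [lintegral_add_right_eq_self (fun x => ‖φ x‖ₑ), lintegral_const, measure_univ,
      mul_one]
    exact hφ.integrable.2
  simp_rw [pairing_eq_tsum]
  rw [h.integral_tsum hm hi, integral_prod_symm _ hi]
  simp [integral_add_right_eq_self φ]

/-- The fluctuation is a compensated sum of the occupation functionals of the particles. -/
lemma IsParticleSystem.fluctuation_ae_eq (h : IsParticleSystem α ξ L P) (hφ : IsTestFunction φ)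
    {T : ℝ} (hT : 0 < T) :
    ∀ᵐ ω ∂P, fluctuation ξ L P T 1 φ ω
      = ∑' i, occupation (fun s p => rightReg p s) φ T (ξ i ω, fun t => L i t ω)
        - √T * ∫ x, φ x := by
  have := h.isProbabilityMeasure_pathLaw
  have hX := h.hasStableIncrements
  have hφm := hφ.measurable
  have hm : Measurable fun q : (ℝ × (ℝ≥0 → ℝ)) × ℝ => φ (q.1.1 + rightReg q.1.2 q.2.toNNReal) :=
    hφm.comp hX.measurable_uncurry_real
  let f : ℝ × (ℝ≥0 → ℝ) → ℝ≥0∞ := fun z =>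
    ∫⁻ s in Set.Ioc 0 T, ‖φ (z.1 + rightReg z.2 s.toNNReal)‖ₑ
  have hf : Measurable f := Measurable.lintegral_prod_right' (f := fun q : (ℝ × (ℝ≥0 → ℝ)) × ℝ =>
    ‖φ (q.1.1 + rightReg q.1.2 q.2.toNNReal)‖ₑ) hm.enorm
  have hfi : ∫⁻ z, f z ∂(volume.prod (pathLaw L P)) ≠ ∞ := by
    obtain ⟨M, C, hM, hC, hb⟩ := hφ.bound
    have h1 : ∀ z, f z ≤ ENNReal.ofReal C * sojourn (fun s p => rightReg p s) M T z := by
      intro z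
      rw [sojourn, ← lintegral_const_mul' _ _ ENNReal.ofReal_ne_top]
      exact lintegral_mono fun s => enorm_le_mul_window hb _
    refine ((lintegral_mono h1).trans_lt ?_).ne
    rw [lintegral_const_mul' _ _ ENNReal.ofReal_ne_top, hX.lintegral_sojourn]
    finiteness
  filter_upwards [ae_all_iff.2 h.rightReg_ae_eq, h.ae_tsum_lt_top hf hfi] with ω hω hsum
  have hmi : ∀ i, Measurable fun s : ℝ => φ (ξ i ω + rightReg (fun t => L i t ω) s.toNNReal) :=
    fun i => hm.comp (measurable_prodMk_left (x := (ξ i ω, fun t => L i t ω)))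
  have h1 : ∫ s in (0 : ℝ)..(T * 1), pairing ξ L φ s.toNNReal ω
      = ∑' i, ∫ s in Set.Ioc 0 T, φ (ξ i ω + rightReg (fun t => L i t ω) s.toNNReal) := by
    rw [mul_one, intervalIntegral.integral_of_le hT.le,
      ← MeasureTheory.integral_tsum (fun i => (hmi i).aestronglyMeasurable) hsum.ne]
    congr 1 with s
    rw [pairing_eq_tsum]
    congr 1 with i
    rw [hω]
  rw [fluctuation, h1]
  simp_rw [h.integral_pairing hφ]
  rw [intervalIntegral.integral_const, mul_sub, ← tsum_mul_left]
  congr 1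
  have h3 : 0 < √T := Real.sqrt_pos.2 hT
  rw [mul_one, sub_zero, smul_eq_mul, ← mul_assoc, one_div_mul_eq_div, Real.div_sqrt]

omit [IsProbabilityMeasure P] in
/-- For `T ≤ 0` the fluctuation has its junk value `0`, because `1 / √T = 0`. -/
lemma fluctuation_of_nonpos {T : ℝ} (hT : T ≤ 0) (ω : Ω) : fluctuation ξ L P T 1 φ ω = 0 := by
  simp [fluctuation, Real.sqrt_eq_zero_of_nonpos hT]

lemma IsParticleSystem.aemeasurable_fluctuation (h : IsParticleSystem α ξ L P)
    (hφ : IsTestFunction φ) (T : ℝ) : AEMeasurable (fluctuation ξ L P T 1 φ) P := by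
  rcases le_or_gt T 0 with hT | hT
  · rw [show fluctuation ξ L P T 1 φ = fun _ => 0 from funext (fluctuation_of_nonpos hT)]
    exact aemeasurable_const
  have := h.isProbabilityMeasure_pathLaw
  have hm := measurable_occupation h.hasStableIncrements hφ.measurable T
  exact ⟨_, (Measurable.tsum fun i => hm.comp (h.measurable_position_path i)).sub_const _,
    h.fluctuation_ae_eq hφ hT⟩

/-- Convergence of the characteristic functions of the fluctuations of one test function. -/
lemma IsParticleSystem.tendsto_integral_cexp_fluctuation (h : IsParticleSystem α ξ L P)
    (hφ : IsTestFunction φ) (hα0 : 0 < α) (hα1 : α < 1) :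
    Tendsto (fun T => ∫ ω, Complex.exp ((fluctuation ξ L P T 1 φ ω : ℂ) * Complex.I) ∂P) atTop
      (𝓝 (Complex.exp (-(limitVariance α φ : ℂ) / 2))) := by
  have := h.isProbabilityMeasure_pathLaw
  have hX := h.hasStableIncrements
  refine (hφ.tendsto_cexp_occupation hX hα0 hα1).congr' ?_
  filter_upwards [eventually_gt_atTop 0] with T hT
  rw [← h.integral_exp_tsum (measurable_occupation hX hφ.measurable T)
    (hφ.integrable_occupation hX T), ← integral_mul_const]
  refine integral_congr_ae ?_
  filter_upwards [h.fluctuation_ae_eq hφ hT] with ω hω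
  rw [hω, ← Complex.exp_add]
  congr 1
  push_cast
  ring

end Fluctuation

/-! ### Linear combinations of test functions -/

section LinearCombination

lemma hat_sum_smul {n : ℕ} (a : Fin n → ℝ) {ψ : Fin n → ℝ → ℝ} (hψ : ∀ k, Integrable (ψ k))
    (u : ℝ) : hat (fun x => ∑ k, a k * ψ k x) u = ∑ k, a k * hat (ψ k) u := by
  have hi : ∀ k, Integrable fun y : ℝ => Complex.exp (Complex.I * u * y) * ψ k y := by
    intro k
    refine (hψ k).norm.mono' ?_ (ae_of_all _ fun y => ?_)
    · have hc : Continuous fun y : ℝ => Complex.exp (Complex.I * u * y) := by fun_prop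
      exact hc.aestronglyMeasurable.mul (hψ k).ofReal.aestronglyMeasurable
    · have := Complex.norm_exp_ofReal_mul_I (u * y)
      rw [norm_mul, show Complex.I * u * y = ((u * y : ℝ) : ℂ) * Complex.I by push_cast; ring, this,
        one_mul, Complex.norm_real]
  unfold hat
  simp_rw [← integral_const_mul]
  rw [← integral_finsetSum _ fun k _ => (hi k).const_mul _]
  congr 1 with y
  push_cast
  rw [Finset.mul_sum]
  refine Finset.sum_congr rfl fun k _ => ?_
  ring

lemma IsTestFunction.sum_smul {n : ℕ} (a : Fin n → ℝ) {ψ : Fin n → ℝ → ℝ}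
    (hψ : ∀ k, IsTestFunction (ψ k)) : IsTestFunction fun x => ∑ k, a k * ψ k x := by
  have hi := fun k => (hψ k).integrable
  refine ⟨?_, ?_, ?_, ?_⟩
  · have := fun k => (hψ k).measurable
    fun_prop
  · choose M C hM hC hb using fun k => (hψ k).bound
    refine ⟨∑ k, M k, ∑ k, |a k| * C k, Finset.sum_nonneg fun k _ => hM k,
      Finset.sum_nonneg fun k _ => mul_nonneg (abs_nonneg _) (hC k), fun x => ?_⟩
    have hk : ∀ k, |a k * ψ k x|
        ≤ (Set.Icc (-∑ k, M k) (∑ k, M k)).indicator (fun _ => |a k| * C k) x := by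
      intro k
      have hMk : M k ≤ ∑ k, M k := Finset.single_le_sum (fun k _ => hM k) (Finset.mem_univ k)
      rw [abs_mul]
      have h1 := hb k x
      by_cases hx : x ∈ Set.Icc (-∑ k, M k) (∑ k, M k)
      · rw [Set.indicator_of_mem hx]
        gcongr
        exact h1.trans (Set.indicator_le_self' (fun _ _ => hC k) _)
      · rw [Set.indicator_of_notMem hx]
        have hx' : x ∉ Set.Icc (-M k) (M k) := fun h' =>
          hx ⟨(neg_le_neg hMk).trans h'.1, h'.2.trans hMk⟩
        rw [Set.indicator_of_notMem hx'] at h1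
        exact mul_nonpos_of_nonneg_of_nonpos (abs_nonneg _) h1
    refine (Finset.abs_sum_le_sum_abs _ _).trans ((Finset.sum_le_sum fun k _ => hk k).trans ?_)
    rw [← Finset.sum_apply, ← Finset.indicator_sum]
    simp [Set.indicator]
  · filter_upwards [ae_all_iff.2 fun k => (hψ k).ae_continuousAt] with x hx
    exact tendsto_finsetSum _ fun k _ => (hx k).const_mul _
  · have hhm : ∀ k, MemLp (hat (ψ k)) 2 := fun k =>
      (memLp_two_iff_integrable_sq_norm (measurable_hat (hψ k).measurable).aestronglyMeasurable).2
        (hψ k).integrable_hat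
    have hs : MemLp (fun u => ∑ k, (a k : ℂ) * hat (ψ k) u) 2 :=
      memLp_finsetSum _ fun k _ => (hhm k).const_mul _
    simp_rw [hat_sum_smul a hi]
    exact (memLp_two_iff_integrable_sq_norm hs.1).1 hs

variable {Ω : Type*} [MeasurableSpace Ω] {P : Measure Ω} [IsProbabilityMeasure P] {α : ℝ}
  {ξ : ℕ → Ω → ℝ} {L : ℕ → ℝ≥0 → Ω → ℝ}

lemma IsParticleSystem.fluctuation_sum_smul (h : IsParticleSystem α ξ L P) {n : ℕ} (a : Fin n → ℝ)
    {ψ : Fin n → ℝ → ℝ} (hψ : ∀ k, IsTestFunction (ψ k)) {T : ℝ} (hT : 0 < T) :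
    ∀ᵐ ω ∂P, fluctuation ξ L P T 1 (fun x => ∑ k, a k * ψ k x) ω
      = ∑ k, a k * fluctuation ξ L P T 1 (ψ k) ω := by
  have := h.isProbabilityMeasure_pathLaw
  have hX := h.hasStableIncrements
  have hsum : ∀ᵐ ω ∂P, ∀ k, Summable fun i =>
      occupation (fun s p => rightReg p s) (ψ k) T (ξ i ω, fun t => L i t ω) :=
    ae_all_iff.2 fun k => h.ae_summable (measurable_occupation hX (hψ k).measurable T)
      ((hψ k).integrable_occupation hX T)
  have hocc : ∀ z, occupation (fun s p => rightReg p s) (fun x => ∑ k, a k * ψ k x) T z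
      = ∑ k, a k * occupation (fun s p => rightReg p s) (ψ k) T z := by
    intro z
    unfold occupation
    rw [integral_finsetSum _ fun k _ => ((hψ k).integrable_path hX T z).const_mul _,
      Finset.mul_sum]
    refine Finset.sum_congr rfl fun k _ => ?_
    rw [integral_const_mul]
    ring
  filter_upwards [h.fluctuation_ae_eq (IsTestFunction.sum_smul a hψ) hT, hsum,
    ae_all_iff.2 fun k => h.fluctuation_ae_eq (hψ k) hT] with ω h1 h2 h3
  rw [h1]
  simp_rw [h3, hocc]
  rw [Summable.tsum_finsetSum fun k _ => (h2 k).mul_left _,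
    integral_finsetSum _ fun k _ => (hψ k).integrable.const_mul _, Finset.mul_sum,
    ← Finset.sum_sub_distrib]
  refine Finset.sum_congr rfl fun k _ => ?_
  rw [tsum_mul_left, integral_const_mul]
  ring

end LinearCombination

/-! ### The spectral form -/

section Spectral

variable {α : ℝ} {φ χ : ℝ → ℝ}

lemma IsTestFunction.integrable_spectralIntegrand (hφ : IsTestFunction φ) (hχ : IsTestFunction χ)
    (hα0 : 0 < α) (hα1 : α < 1) : Integrable (spectralIntegrand α φ χ) := by
  have h1 := hφ.integrable_spectral hα0 hα1
  have h2 := hχ.integrable_spectral hα0 hα1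
  have hm1 := measurable_hat hφ.measurable
  have hm2 := measurable_hat hχ.measurable
  refine (h1.add h2).mono' (Measurable.aestronglyMeasurable ?_) (ae_of_all _ fun x => ?_)
  · unfold spectralIntegrand
    have : Measurable fun x => (starRingEnd ℂ) (hat χ x) :=
      Complex.continuous_conj.measurable.comp hm2
    fun_prop
  · have hw : 0 ≤ 1 / |x| ^ α := by positivity
    simp only [spectralIntegrand, norm_mul, RCLike.norm_conj, Complex.norm_real, Real.norm_eq_abs,
      abs_of_nonneg hw, Pi.add_apply, ← add_mul]
    gcongr
    nlinarith [sq_nonneg (‖hat φ x‖ - ‖hat χ x‖), norm_nonneg (hat φ x), norm_nonneg (hat χ x)]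

lemma spectralIntegrand_neg (x : ℝ) :
    spectralIntegrand α φ χ (-x) = (starRingEnd ℂ) (spectralIntegrand α φ χ x) := by
  simp [spectralIntegrand, hat_neg]

/-- The spectral form of real functions is real. -/
lemma spectralForm_eq_ofReal (h : Integrable (spectralIntegrand α φ χ)) :
    spectralForm α φ χ
      = ((1 / Real.pi * ∫ x, (spectralIntegrand α φ χ x).re : ℝ) : ℂ) := by
  have h1 : (starRingEnd ℂ) (∫ x, spectralIntegrand α φ χ x) = ∫ x, spectralIntegrand α φ χ x := by
    rw [← integral_conj, ← integral_neg_eq_self]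
    simp_rw [spectralIntegrand_neg, Complex.conj_conj]
  have h2 : ∫ x, (spectralIntegrand α φ χ x).re = (∫ x, spectralIntegrand α φ χ x).re :=
    integral_re h
  rw [spectralForm, h2]
  push_cast
  rw [Complex.conj_eq_iff_re.1 h1]

lemma re_spectralForm (h : Integrable (spectralIntegrand α φ χ)) :
    (spectralForm α φ χ).re = 1 / Real.pi * ∫ x, (spectralIntegrand α φ χ x).re := by
  rw [spectralForm_eq_ofReal h, Complex.ofReal_re]

/-- The limiting variance of a linear combination is a quadratic form. -/
lemma limitVariance_sum_smul (hα0 : 0 < α) (hα1 : α < 1) {n : ℕ} (a : Fin n → ℝ)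
    {ψ : Fin n → ℝ → ℝ} (hψ : ∀ k, IsTestFunction (ψ k)) :
    limitVariance α (fun x => ∑ k, a k * ψ k x)
      = ∑ j, ∑ k, a j * a k * (spectralForm α (ψ j) (ψ k)).re := by
  have hint : ∀ j k, Integrable (spectralIntegrand α (ψ j) (ψ k)) := fun j k =>
    (hψ j).integrable_spectralIntegrand (hψ k) hα0 hα1
  have hpt : ∀ x, ‖hat (fun x => ∑ k, a k * ψ k x) x‖ ^ 2 * (1 / |x| ^ α)
      = ∑ j, ∑ k, a j * a k * (spectralIntegrand α (ψ j) (ψ k) x).re := by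
    intro x
    have h1 : ((‖hat (fun x => ∑ k, a k * ψ k x) x‖ ^ 2 * (1 / |x| ^ α) : ℝ) : ℂ)
        = ∑ j, ∑ k, ((a j * a k : ℝ) : ℂ) * spectralIntegrand α (ψ j) (ψ k) x := by
      rw [← Complex.normSq_eq_norm_sq, Complex.ofReal_mul, ← Complex.mul_conj,
        hat_sum_smul a fun k => (hψ k).integrable, map_sum, Finset.sum_mul_sum, Finset.sum_mul]
      refine Finset.sum_congr rfl fun j _ => ?_
      rw [Finset.sum_mul]
      refine Finset.sum_congr rfl fun k _ => ?_
      simp only [spectralIntegrand, map_mul, Complex.conj_ofReal]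
      push_cast
      ring
    have h2 := congrArg Complex.re h1
    simpa only [Complex.ofReal_re, Complex.re_sum, Complex.re_ofReal_mul] using h2
  have hre : ∀ j k, Integrable fun x => (spectralIntegrand α (ψ j) (ψ k) x).re := fun j k =>
    (hint j k).re
  simp_rw [limitVariance, hpt]
  rw [integral_finsetSum _ fun j _ => integrable_finsetSum _ fun k _ => (hre j k).const_mul _,
    Finset.mul_sum]
  refine Finset.sum_congr rfl fun j _ => ?_
  rw [integral_finsetSum _ fun k _ => (hre j k).const_mul _, Finset.mul_sum]
  refine Finset.sum_congr rfl fun k _ => ?_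
  rw [integral_const_mul, re_spectralForm (hint j k)]
  ring

end Spectral

/-! ### Fourier transforms of the test functions of the three families -/

section Indicators

lemma hat_indicator_Icc {a b : ℝ} (hab : a ≤ b) {x : ℝ} (hx : x ≠ 0) :
    hat ((Set.Icc a b).indicator 1) x
      = (Complex.exp (Complex.I * x * b) - Complex.exp (Complex.I * x * a)) / (Complex.I * x) := by
  have h1 : (fun y : ℝ => Complex.exp (Complex.I * x * y) * (((Set.Icc a b).indicator 1 y : ℝ) : ℂ))
      = (Set.Icc a b).indicator fun y : ℝ => Complex.exp (Complex.I * x * y) := by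
    ext y
    by_cases hy : y ∈ Set.Icc a b <;> simp [hy]
  rw [hat, h1, integral_indicator measurableSet_Icc, integral_Icc_eq_integral_Ioc,
    ← intervalIntegral.integral_of_le hab, integral_exp_mul_complex]
  exact mul_ne_zero Complex.I_ne_zero (Complex.ofReal_ne_zero.2 hx)

lemma isTestFunction_indicator_Icc {a b : ℝ} (hab : a ≤ b) :
    IsTestFunction ((Set.Icc a b).indicator 1) := by
  have hm : Measurable ((Set.Icc a b).indicator (1 : ℝ → ℝ)) :=
    measurable_one.indicator measurableSet_Icc
  refine ⟨hm, ⟨max |a| |b|, 1, by positivity, zero_le_one, fun x => ?_⟩, ?_, ?_⟩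
  · by_cases hx : x ∈ Set.Icc a b
    · have hx' : x ∈ Set.Icc (-max |a| |b|) (max |a| |b|) :=
        ⟨(neg_le_neg (le_max_left _ _)).trans ((neg_abs_le a).trans hx.1),
          hx.2.trans ((le_abs_self b).trans (le_max_right _ _))⟩
      simp [hx, hx']
    · rw [Set.indicator_of_notMem hx, abs_zero]
      exact Set.indicator_nonneg (fun _ _ => zero_le_one) _
  · have h1 : ∀ᵐ x : ℝ, x ∉ ({a, b} : Set ℝ) :=
      (Set.toFinite ({a, b} : Set ℝ)).countable.ae_notMem _
    filter_upwards [h1] with x hx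
    simp only [Set.mem_insert_iff, Set.mem_singleton_iff, not_or] at hx
    refine ContinuousOn.continuousAt_indicator (f := 1) continuousOn_const ?_
    rw [frontier_Icc hab]
    simpa using hx
  -- `|φ̂(x)|² ≤ (M² + 4) / (1 + x²)`, since `|φ̂| ≤ M` and `|x φ̂(x)| ≤ 2`.
  · have hM : ∀ x, ‖hat ((Set.Icc a b).indicator 1) x‖
        ≤ ∫ y, |(Set.Icc a b).indicator (1 : ℝ → ℝ) y| := norm_hat_le _
    set M := ∫ y, |(Set.Icc a b).indicator (1 : ℝ → ℝ) y|
    refine (integrable_inv_one_add_sq.const_mul (M ^ 2 + 4)).mono'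
      ((measurable_hat hm).norm.pow_const 2).aestronglyMeasurable ?_
    have hne : ∀ᵐ u : ℝ, u ≠ 0 := by simp [ae_iff]
    filter_upwards [hne] with x hx
    have h1 : ‖hat ((Set.Icc a b).indicator 1) x‖ * |x| ≤ 2 := by
      have e : ∀ c : ℝ, ‖Complex.exp (Complex.I * x * c)‖ = 1 := by
        intro c
        rw [← Complex.norm_exp_ofReal_mul_I (x * c)]
        congr 2
        push_cast
        ring
      rw [hat_indicator_Icc hab hx, norm_div, norm_mul, Complex.norm_I, one_mul, Complex.norm_real,
        Real.norm_eq_abs, div_mul_cancel₀ _ (abs_ne_zero.2 hx)]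
      exact (norm_sub_le _ _).trans (by rw [e, e]; norm_num)
    rw [norm_pow, norm_norm, ← div_eq_mul_inv, le_div_iff₀ (by positivity), mul_add, mul_one,
      ← sq_abs x, ← mul_pow]
    have h2 := hM x
    have h3 : (‖hat ((Set.Icc a b).indicator 1) x‖ * |x|) ^ 2 ≤ 2 ^ 2 := by gcongr
    have h4 : ‖hat ((Set.Icc a b).indicator 1) x‖ ^ 2 ≤ M ^ 2 := by gcongr
    linarith

lemma isTestFunction_sub {φ χ : ℝ → ℝ} (hφ : IsTestFunction φ) (hχ : IsTestFunction χ) :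
    IsTestFunction (φ - χ) := by
  have h := IsTestFunction.sum_smul ![1, -1] (ψ := ![φ, χ])
    (by intro k; fin_cases k <;> assumption)
  convert h using 1
  ext x
  simp [Fin.sum_univ_two, sub_eq_add_neg]

lemma hat_sub {φ χ : ℝ → ℝ} (hφ : IsTestFunction φ) (hχ : IsTestFunction χ) (x : ℝ) :
    hat (φ - χ) x = hat φ x - hat χ x := by
  have h := hat_sum_smul ![1, -1] (ψ := ![φ, χ])
    (by intro k; fin_cases k; exacts [hφ.integrable, hχ.integrable]) x
  have e : (fun y => ∑ k, (![1, -1] : Fin 2 → ℝ) k * (![φ, χ] : Fin 2 → ℝ → ℝ) k y) = φ - χ := by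
    ext y
    simp [Fin.sum_univ_two, sub_eq_add_neg]
  rw [e] at h
  simpa [Fin.sum_univ_two, sub_eq_add_neg] using h

lemma Family.isTestFunction_psi (F : Family) (t : ℝ≥0) : IsTestFunction (F.psi t) := by
  have h1 : (0 : ℝ) ≤ t := t.2
  have h2 : -(t : ℝ) ≤ 0 := neg_nonpos.2 h1
  cases F
  · exact isTestFunction_indicator_Icc h1
  · exact isTestFunction_sub (isTestFunction_indicator_Icc h1) (isTestFunction_indicator_Icc h2)
  · exact isTestFunction_indicator_Icc (h2.trans h1)

end Indicators

/-! ### The structure function of the spectral density -/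

section StructureFunction

variable {α : ℝ}

/-- The integral `∫ (1 - cos (b x)) |x|^{-2-α} dx`, the structure function of the spectral density
`|x|^{-2-α}`. -/
def structureFunction (α b : ℝ) : ℝ := ∫ x : ℝ, (1 - Real.cos (b * x)) / x ^ 2 * (1 / |x| ^ α)

/-- The structure function is a multiple of `|b|^{1+α}`, by scaling. -/
lemma structureFunction_eq (hα0 : 0 < α) (b : ℝ) :
    structureFunction α b = structureFunction α 1 * |b| ^ (1 + α) := by
  rcases eq_or_ne b 0 with rfl | hb
  · simp [structureFunction, Real.zero_rpow (by positivity : 1 + α ≠ 0)]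
  have hb' : 0 < |b| := abs_pos.2 hb
  let g : ℝ → ℝ := fun x => (1 - Real.cos (1 * x)) / x ^ 2 * (1 / |x| ^ α)
  have h1 : ∀ x, (1 - Real.cos (b * x)) / x ^ 2 * (1 / |x| ^ α) = |b| ^ (2 + α) * g (b * x) := by
    intro x
    simp only [g, one_mul]
    rw [abs_mul, Real.mul_rpow hb'.le (abs_nonneg _), Real.rpow_add hb', mul_pow,
      show |b| ^ (2 : ℝ) = b ^ 2 by rw [Real.rpow_ofNat, sq_abs]]
    have : |b| ^ α ≠ 0 := (Real.rpow_pos_of_pos hb' α).ne'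
    rcases eq_or_ne x 0 with rfl | hx
    · simp
    have : |x| ^ α ≠ 0 := (Real.rpow_pos_of_pos (abs_pos.2 hx) α).ne'
    field_simp
  rw [structureFunction]
  simp_rw [h1]
  rw [integral_const_mul, Measure.integral_comp_mul_left, smul_eq_mul, ← mul_assoc, abs_inv,
    show (2 : ℝ) + α = 1 + α + 1 by ring, Real.rpow_add_one hb'.ne',
    mul_assoc (|b| ^ (1 + α)), mul_inv_cancel₀ hb'.ne', mul_one, mul_comm]
  rfl

/-- Up to a constant the integrand is `|φ̂(x)|² |x|^{-α}` for the indicator `φ` of `[0, b]`. -/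
lemma integrable_one_sub_cos (hα0 : 0 < α) (hα1 : α < 1) (b : ℝ) :
    Integrable fun x : ℝ => (1 - Real.cos (b * x)) / x ^ 2 * (1 / |x| ^ α) := by
  have key : ∀ b : ℝ, 0 ≤ b →
      Integrable fun x : ℝ => (1 - Real.cos (b * x)) / x ^ 2 * (1 / |x| ^ α) := by
    intro b hb
    have h1 := ((isTestFunction_indicator_Icc hb).integrable_spectral hα0 hα1).const_mul (1 / 2)
    refine h1.congr ?_
    have hne : ∀ᵐ u : ℝ, u ≠ 0 := by simp [ae_iff]
    filter_upwards [hne] with x hx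
    have h2 : ‖hat ((Set.Icc 0 b).indicator 1) x‖ ^ 2 = 2 * ((1 - Real.cos (b * x)) / x ^ 2) := by
      rw [hat_indicator_Icc hb hx, norm_div, div_pow, norm_mul, Complex.norm_I, one_mul,
        Complex.norm_real, Real.norm_eq_abs, sq_abs,
        show Complex.I * x * b = ((b * x : ℝ) : ℂ) * Complex.I by push_cast; ring,
        Complex.exp_mul_I, ← Complex.normSq_eq_norm_sq, Complex.normSq_apply,
        ← Complex.ofReal_cos, ← Complex.ofReal_sin]
      have hsc := Real.sin_sq_add_cos_sq (b * x)
      generalize Real.cos (b * x) = C at hsc ⊢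
      generalize Real.sin (b * x) = D at hsc ⊢
      simp
      rw [← mul_div_assoc]
      congr 1
      linear_combination hsc
    rw [h2]
    ring
  rcases le_total 0 b with hb | hb
  · exact key b hb
  · refine (key (-b) (neg_nonneg.2 hb)).congr (ae_of_all _ fun x => ?_)
    simp only [neg_mul, Real.cos_neg]

lemma structureFunction_one_pos (hα0 : 0 < α) (hα1 : α < 1) : 0 < structureFunction α 1 := by
  have hnn : ∀ x : ℝ, 0 ≤ (1 - Real.cos (1 * x)) / x ^ 2 * (1 / |x| ^ α) := by
    intro x
    have := Real.cos_le_one (1 * x)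
    have : 0 ≤ 1 - Real.cos (1 * x) := by linarith
    positivity
  rw [structureFunction, integral_pos_iff_support_of_nonneg hnn (integrable_one_sub_cos hα0 hα1 1)]
  have hsub : Set.Ioo (0 : ℝ) 1 ⊆
      Function.support fun x : ℝ => (1 - Real.cos (1 * x)) / x ^ 2 * (1 / |x| ^ α) := by
    intro x hx
    have h1 : Real.cos (1 * x) < 1 := by
      rw [one_mul, ← Real.cos_zero]
      exact Real.cos_lt_cos_of_nonneg_of_le_pi le_rfl (by linarith [hx.2, Real.pi_gt_three]) hx.1
    have h2 : 0 < |x| ^ α := Real.rpow_pos_of_pos (abs_pos.2 hx.1.ne') α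
    have h3 : 0 < 1 - Real.cos (1 * x) := by linarith
    have h4 : 0 < x ^ 2 := pow_pos hx.1 2
    exact (by positivity : 0 < (1 - Real.cos (1 * x)) / x ^ 2 * (1 / |x| ^ α)).ne'
  refine lt_of_lt_of_le ?_ (measure_mono hsub)
  simp

end StructureFunction

/-! ### The covariances of the three families -/

section Covariance

variable {α H : ℝ}

lemma hat_psi_positive (t : ℝ≥0) {x : ℝ} (hx : x ≠ 0) :
    hat (Family.positive.psi t) x
      = ((Real.sin (t * x) / x : ℝ) : ℂ) + ((1 - Real.cos (t * x)) / x : ℝ) * Complex.I := by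
  have hx' : (x : ℂ) ≠ 0 := Complex.ofReal_ne_zero.2 hx
  rw [Family.psi, hat_indicator_Icc t.coe_nonneg hx,
    show Complex.I * x * ((t : ℝ) : ℂ) = ((t * x : ℝ) : ℂ) * Complex.I by push_cast; ring,
    Complex.exp_mul_I, ← Complex.ofReal_cos, ← Complex.ofReal_sin]
  push_cast
  field_simp
  simp only [mul_zero, Complex.exp_zero]
  linear_combination ((Complex.cos (t * x) - 1)) * Complex.I_sq

lemma hat_psi_antisymmetric (t : ℝ≥0) {x : ℝ} (hx : x ≠ 0) :
    hat (Family.antisymmetric.psi t) x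
      = ((2 * (1 - Real.cos (t * x)) / x : ℝ) : ℂ) * Complex.I := by
  have hx' : (x : ℂ) ≠ 0 := Complex.ofReal_ne_zero.2 hx
  have h2 : -(t : ℝ) ≤ 0 := neg_nonpos.2 t.coe_nonneg
  rw [Family.psi, hat_sub (isTestFunction_indicator_Icc t.coe_nonneg)
    (isTestFunction_indicator_Icc h2),
    hat_indicator_Icc t.coe_nonneg hx, hat_indicator_Icc h2 hx,
    show Complex.I * x * ((t : ℝ) : ℂ) = ((t * x : ℝ) : ℂ) * Complex.I by push_cast; ring,
    show Complex.I * x * ((-(t : ℝ) : ℝ) : ℂ) = ((-(t * x) : ℝ) : ℂ) * Complex.I by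
      push_cast; ring,
    Complex.exp_mul_I, Complex.exp_mul_I, ← Complex.ofReal_cos, ← Complex.ofReal_sin,
    ← Complex.ofReal_cos, ← Complex.ofReal_sin, Real.cos_neg, Real.sin_neg]
  push_cast
  field_simp
  simp only [mul_zero, Complex.exp_zero]
  linear_combination (2 * (Complex.cos (t * x) - 1)) * Complex.I_sq

lemma hat_psi_symmetric (t : ℝ≥0) {x : ℝ} (hx : x ≠ 0) :
    hat (Family.symmetric.psi t) x = ((2 * Real.sin (t * x) / x : ℝ) : ℂ) := by
  have hx' : (x : ℂ) ≠ 0 := Complex.ofReal_ne_zero.2 hx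
  have h2 : -(t : ℝ) ≤ t := neg_le_self t.coe_nonneg
  rw [Family.psi, hat_indicator_Icc h2 hx,
    show Complex.I * x * ((t : ℝ) : ℂ) = ((t * x : ℝ) : ℂ) * Complex.I by push_cast; ring,
    show Complex.I * x * ((-(t : ℝ) : ℝ) : ℂ) = ((-(t * x) : ℝ) : ℂ) * Complex.I by
      push_cast; ring,
    Complex.exp_mul_I, Complex.exp_mul_I, ← Complex.ofReal_cos, ← Complex.ofReal_sin,
    ← Complex.ofReal_cos, ← Complex.ofReal_sin, Real.cos_neg, Real.sin_neg]
  push_cast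
  field_simp
  ring

/-- The spectral integrands of the three families are combinations of the functions
`(1 - cos (b x)) |x|^{-2-α}`, which integrate to multiples of `|b|^{2H}`. -/
lemma Family.exists_spectralForm_eq (F : Family) (hα0 : 0 < α) (hα1 : α < 1)
    (hH : H = (1 + α) / 2) :
    ∃ K : ℝ, 0 < K ∧ ∀ s t : ℝ≥0,
      spectralForm α (F.psi t) (F.psi s) = ((K ^ 2 * F.cov H s t : ℝ) : ℂ) := by
  set c := structureFunction α 1 with hc
  have hc0 : 0 < c := structureFunction_one_pos hα0 hα1
  have hpi := Real.pi_pos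
  have h2H : 2 * H = 1 + α := by rw [hH]; ring
  have hH1 : 0 < 1 - H := by rw [hH]; linarith
  have hne : ∀ᵐ u : ℝ, u ≠ 0 := by simp [ae_iff]
  let g : ℝ → ℝ → ℝ := fun b x => (1 - Real.cos (b * x)) / x ^ 2 * (1 / |x| ^ α)
  have hg : ∀ b, Integrable (g b) := integrable_one_sub_cos hα0 hα1
  have hgi : ∀ b, ∫ x, g b x = c * |b| ^ (2 * H) := fun b => by
    rw [h2H]
    exact structureFunction_eq hα0 b
  have habs : ∀ t : ℝ≥0, |(t : ℝ)| = t := fun t => abs_of_nonneg t.coe_nonneg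
  have habs2 : ∀ s t : ℝ≥0, |(t : ℝ) + s| = s + t := fun s t => by
    rw [abs_of_nonneg (add_nonneg t.coe_nonneg s.coe_nonneg), add_comm]
  have hform : ∀ s t, spectralForm α (F.psi t) (F.psi s)
      = ((1 / Real.pi * ∫ x, (spectralIntegrand α (F.psi t) (F.psi s) x).re : ℝ) : ℂ) := fun s t =>
    spectralForm_eq_ofReal
      ((F.isTestFunction_psi t).integrable_spectralIntegrand (F.isTestFunction_psi s) hα0 hα1)
  simp_rw [hform]
  cases F
  · -- `K² / 2 = c / π`
    refine ⟨√(2 * c / Real.pi), by positivity, fun s t => ?_⟩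
    have h1 : ∫ x, (spectralIntegrand α (Family.positive.psi t) (Family.positive.psi s) x).re
        = ∫ x, (g t x + g s x - g (t - s) x) := by
      refine integral_congr_ae ?_
      filter_upwards [hne] with x hx
      simp only [spectralIntegrand, hat_psi_positive _ hx, g, Complex.re_mul_ofReal]
      rw [sub_mul, Real.cos_sub, ← add_mul, ← sub_mul]
      congr 1
      generalize Real.cos (t * x) = C
      generalize Real.sin (t * x) = D
      generalize Real.cos (s * x) = C'
      generalize Real.sin (s * x) = D'
      simp
      field_simp
      ring
    rw [h1, integral_sub (f := fun x => g t x + g s x) ((hg _).add (hg _)) (hg _),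
      integral_add (hg _) (hg _), hgi, hgi, hgi,
      Real.sq_sqrt (by positivity), habs, habs]
    simp only [Family.cov, covFBm]
    congr 1
    field_simp
    ring
  · -- `K² (1 - H) = 4 c / π`
    refine ⟨√(4 * c / (Real.pi * (1 - H))), by positivity, fun s t => ?_⟩
    have h1 : ∫ x, (spectralIntegrand α (Family.antisymmetric.psi t)
          (Family.antisymmetric.psi s) x).re
        = ∫ x, (4 * (g t x + g s x) - 2 * (g (t + s) x + g (t - s) x)) := by
      refine integral_congr_ae ?_
      filter_upwards [hne] with x hx
      simp only [spectralIntegrand, hat_psi_antisymmetric _ hx, g, Complex.re_mul_ofReal]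
      rw [sub_mul, add_mul, Real.cos_sub, Real.cos_add, ← add_mul, ← add_mul, ← mul_assoc,
        ← mul_assoc, ← sub_mul]
      congr 1
      generalize Real.cos (t * x) = C
      generalize Real.sin (t * x) = D
      generalize Real.cos (s * x) = C'
      generalize Real.sin (s * x) = D'
      simp
      field_simp
      ring
    rw [h1, integral_sub (f := fun x => 4 * (g t x + g s x))
      (g := fun x => 2 * (g (t + s) x + g (t - s) x)) (((hg _).add (hg _)).const_mul _)
      (((hg _).add (hg _)).const_mul _),
      integral_const_mul, integral_const_mul, integral_add (hg _) (hg _),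
      integral_add (hg _) (hg _), hgi, hgi, hgi, hgi, Real.sq_sqrt (by positivity), habs, habs,
      habs2]
    simp only [Family.cov, covSubFBm]
    congr 1
    field_simp
    ring
  · -- `K² = 2 c / π`
    refine ⟨√(2 * c / Real.pi), by positivity, fun s t => ?_⟩
    have h1 : ∫ x, (spectralIntegrand α (Family.symmetric.psi t) (Family.symmetric.psi s) x).re
        = ∫ x, 2 * (g (t + s) x - g (t - s) x) := by
      refine integral_congr_ae ?_
      filter_upwards [hne] with x hx
      simp only [spectralIntegrand, hat_psi_symmetric _ hx, g, Complex.re_mul_ofReal]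
      rw [sub_mul, add_mul, Real.cos_sub, Real.cos_add, ← sub_mul, ← mul_assoc]
      congr 1
      generalize Real.cos (t * x) = C
      generalize Real.sin (t * x) = D
      generalize Real.cos (s * x) = C'
      generalize Real.sin (s * x) = D'
      simp
      field_simp
      ring
    rw [h1, integral_const_mul, integral_sub (hg _) (hg _), hgi, hgi,
      Real.sq_sqrt (by positivity), habs2]
    simp only [Family.cov, covOddFBm]
    congr 1
    field_simp

end Covariance

/-! ### Characteristic functions of centered Gaussian processes -/

section Gaussian

variable {Ω : Type*} [MeasurableSpace Ω] {P : Measure Ω} {X : ℝ≥0 → Ω → ℝ} {R : ℝ≥0 → ℝ≥0 → ℝ}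

lemma IsCenteredGaussian.memLp_two (h : IsCenteredGaussian X R P) (t : ℝ≥0) : MemLp (X t) 2 P :=
  (h.gaussian.hasGaussianLaw_eval t).memLp_two

/-- The characteristic functions of the finite-dimensional distributions of a centered Gaussian
process. -/
lemma IsCenteredGaussian.integral_cexp (h : IsCenteredGaussian X R P) {n : ℕ} (t : Fin n → ℝ≥0)
    (a : Fin n → ℝ) :
    ∫ ω, Complex.exp (((∑ k, a k * X (t k) ω : ℝ) : ℂ) * Complex.I) ∂P
      = Complex.exp (-((∑ j, ∑ k, a j * a k * R (t j) (t k) : ℝ) : ℂ) / 2) := by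
  classical
  have := h.gaussian.isProbabilityMeasure
  set Y : Ω → ℝ := fun ω => ∑ k, a k * X (t k) ω with hY
  have hmem : ∀ k, MemLp (fun ω => a k * X (t k) ω) 2 P := fun k => (h.memLp_two (t k)).const_mul _
  have hlaw : HasGaussianLaw Y P := by
    let I := Finset.univ.image t
    have hI : ∀ k, t k ∈ I := fun k => Finset.mem_image_of_mem t (Finset.mem_univ k)
    let l : (I → ℝ) →L[ℝ] ℝ := ∑ k, a k • ContinuousLinearMap.proj (R := ℝ) ⟨t k, hI k⟩
    have h1 := (h.gaussian.hasGaussianLaw I).map l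
    have h2 : Y = l ∘ fun ω => I.restrict (X · ω) := by
      ext ω
      simp [Y, l]
    rw [h2]
    exact h1
  have hmean : ∫ ω, Y ω ∂P = 0 := by
    rw [hY, integral_finsetSum _ fun k _ => (hmem k).integrable (by norm_num)]
    simp_rw [integral_const_mul, h.centered]
    simp
  have hvar : Var[Y; P] = ∑ j, ∑ k, a j * a k * R (t j) (t k) := by
    rw [variance_of_integral_eq_zero hlaw.aemeasurable hmean]
    have h2 : ∀ ω, (Y ω) ^ 2 = ∑ j, ∑ k, a j * a k * (X (t j) ω * X (t k) ω) := by
      intro ω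
      rw [sq, hY, Finset.sum_mul_sum]
      refine Finset.sum_congr rfl fun j _ => Finset.sum_congr rfl fun k _ => ?_
      ring
    have h3 : ∀ j k, Integrable (fun ω => a j * a k * (X (t j) ω * X (t k) ω)) P := fun j k =>
      ((h.memLp_two (t j)).integrable_mul (h.memLp_two (t k))).const_mul _
    simp_rw [h2]
    rw [integral_finsetSum _ fun j _ => integrable_finsetSum _ fun k _ => h3 j k]
    refine Finset.sum_congr rfl fun j _ => ?_
    rw [integral_finsetSum _ fun k _ => h3 j k]
    refine Finset.sum_congr rfl fun k _ => ?_
    rw [integral_const_mul, h.covariance]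
  have h4 := hlaw.charFun_map_eq 1
  rw [charFun_apply_real, integral_map hlaw.aemeasurable
    (by fun_prop : Continuous _).aestronglyMeasurable] at h4
  change ∫ ω, Complex.exp ((Y ω : ℂ) * Complex.I) ∂P = _
  simpa [hmean, hvar, neg_div] using h4

/-- A linear combination of the values of a process with Gaussian characteristic functions is a
Gaussian variable. -/
lemma map_sum_eq_gaussianReal [IsProbabilityMeasure P] (hX : ∀ t, AEMeasurable (X t) P) {n : ℕ}
    (t : Fin n → ℝ≥0) (a : Fin n → ℝ)
    (h : ∀ b : Fin n → ℝ, ∫ ω, Complex.exp (((∑ k, b k * X (t k) ω : ℝ) : ℂ) * Complex.I) ∂P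
      = Complex.exp (-((∑ j, ∑ k, b j * b k * R (t j) (t k) : ℝ) : ℂ) / 2)) :
    0 ≤ ∑ j, ∑ k, a j * a k * R (t j) (t k) ∧
    P.map (fun ω => ∑ k, a k * X (t k) ω)
      = gaussianReal 0 (∑ j, ∑ k, a j * a k * R (t j) (t k)).toNNReal := by
  have hm : AEMeasurable (fun ω => ∑ k, a k * X (t k) ω) P := by
    have := fun k => hX (t k)
    fun_prop
  set q := ∑ j, ∑ k, a j * a k * R (t j) (t k) with hq
  -- a characteristic function is bounded by `1`
  have hq0 : 0 ≤ q := by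
    have h1 := norm_integral_le_integral_norm (μ := P)
      fun ω => Complex.exp (((∑ k, a k * X (t k) ω : ℝ) : ℂ) * Complex.I)
    simp_rw [Complex.norm_exp_ofReal_mul_I] at h1
    rw [h a, Complex.norm_exp] at h1
    simp only [integral_const, probReal_univ, smul_eq_mul, mul_one, Real.exp_le_one_iff] at h1
    rw [show (-((q : ℝ) : ℂ) / 2) = ((-q / 2 : ℝ) : ℂ) by push_cast; ring, Complex.ofReal_re] at h1
    linarith
  refine ⟨hq0, ?_⟩
  have : IsProbabilityMeasure (P.map fun ω => ∑ k, a k * X (t k) ω) :=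
    Measure.isProbabilityMeasure_map hm
  refine Measure.ext_of_charFun ?_
  ext u
  rw [charFun_gaussianReal, charFun_apply_real, integral_map hm
    (by fun_prop : Continuous _).aestronglyMeasurable]
  have h2 := h fun k => u * a k
  have h3 : ∑ j, ∑ k, u * a j * (u * a k) * R (t j) (t k) = u ^ 2 * q := by
    rw [hq, Finset.mul_sum]
    refine Finset.sum_congr rfl fun j _ => ?_
    rw [Finset.mul_sum]
    refine Finset.sum_congr rfl fun k _ => ?_
    ring
  rw [h3] at h2
  have h4 : ∀ ω, (u : ℂ) * ((∑ k, a k * X (t k) ω : ℝ) : ℂ)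
      = ((∑ k, u * a k * X (t k) ω : ℝ) : ℂ) := by
    intro ω
    rw [← Complex.ofReal_mul, Finset.mul_sum]
    simp_rw [mul_assoc]
  simp_rw [h4]
  rw [h2]
  congr 1
  have h5 : ((q.toNNReal : ℝ) : ℂ) = (q : ℂ) := by rw [Real.coe_toNNReal _ hq0]
  rw [h5]
  push_cast
  ring

/-- A process whose finite-dimensional distributions have centered Gaussian characteristic functions
is a centered Gaussian process. -/
lemma isCenteredGaussian_of_integral_cexp [IsProbabilityMeasure P] (hX : ∀ t, AEMeasurable (X t) P)
    (hR : ∀ s t, R s t = R t s)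
    (h : ∀ (n : ℕ) (t : Fin n → ℝ≥0) (a : Fin n → ℝ),
      ∫ ω, Complex.exp (((∑ k, a k * X (t k) ω : ℝ) : ℂ) * Complex.I) ∂P
        = Complex.exp (-((∑ j, ∑ k, a j * a k * R (t j) (t k) : ℝ) : ℂ) / 2)) :
    IsCenteredGaussian X R P := by
  classical
  have hgauss : IsGaussianProcess X P := by
    refine ⟨fun I => ⟨isGaussian_of_map_eq_gaussianReal fun l => ⟨0, ?_⟩⟩⟩
    have hmI : AEMeasurable (fun ω => I.restrict (X · ω)) P :=
      aemeasurable_pi_lambda _ fun i => hX i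
    let e := I.equivFin
    have h1 := (map_sum_eq_gaussianReal (R := R) hX (fun k => (e.symm k : ℝ≥0))
      (fun k => l (Pi.single (e.symm k) 1)) (h _ _)).2
    refine ⟨_, Eq.trans ?_ h1⟩
    rw [AEMeasurable.map_map_of_aemeasurable l.continuous.aemeasurable hmI]
    congr 1
    ext ω
    rw [Equiv.sum_comp e.symm (fun i : I => l (Pi.single i 1) * X i ω), Function.comp_apply]
    conv_lhs => rw [← Finset.univ_sum_single (I.restrict (X · ω)), map_sum]
    refine Finset.sum_congr rfl fun i _ => ?_
    have h2 : Pi.single i (I.restrict (X · ω) i) = X i ω • (Pi.single i (1 : ℝ) : I → ℝ) := by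
      rw [← Pi.single_smul]
      simp
    rw [h2, map_smul, smul_eq_mul, mul_comm]
  have hmem : ∀ t, MemLp (X t) 2 P := fun t => (hgauss.hasGaussianLaw_eval t).memLp_two
  have hone : ∀ t, P.map (X t) = gaussianReal 0 (R t t).toNNReal ∧ 0 ≤ R t t := by
    intro t
    have h1 := map_sum_eq_gaussianReal (R := R) hX (fun _ : Fin 1 => t) (fun _ => 1) (h _ _)
    simpa using And.intro h1.2 h1.1
  have hcent : ∀ t, ∫ ω, X t ω ∂P = 0 := by
    intro t
    rw [← integral_map (f := fun x : ℝ => x) (hX t) aestronglyMeasurable_id, (hone t).1,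
      integral_id_gaussianReal]
  have hsq : ∀ t, ∫ ω, X t ω ^ 2 ∂P = R t t := by
    intro t
    rw [← variance_of_integral_eq_zero (hX t) (hcent t), ← Function.id_comp (X t),
      ← variance_map aemeasurable_id (hX t), (hone t).1, variance_id_gaussianReal,
      Real.coe_toNNReal _ (hone t).2]
  -- polarization, from the variance of `X_s + X_t`
  refine ⟨hgauss, hcent, fun s t => ?_⟩
  have h1 := map_sum_eq_gaussianReal (R := R) hX ![s, t] ![1, 1] (h _ _)
  simp only [Fin.sum_univ_two, Matrix.cons_val_zero, Matrix.cons_val_one, one_mul] at h1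
  have hst : AEMeasurable (fun ω => X s ω + X t ω) P := (hX s).add (hX t)
  have hi : ∀ r, Integrable (X r) P := fun r => (hmem r).integrable (by norm_num)
  have h2 : ∫ ω, (X s ω + X t ω) ^ 2 ∂P = R s s + R s t + (R t s + R t t) := by
    have h3 : ∫ ω, (X s ω + X t ω) ∂P = 0 := by
      rw [integral_add (hi s) (hi t), hcent, hcent, add_zero]
    rw [← variance_of_integral_eq_zero hst h3, ← Function.id_comp (fun ω => X s ω + X t ω),
      ← variance_map aemeasurable_id hst, h1.2, variance_id_gaussianReal,
      Real.coe_toNNReal _ h1.1]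
  have h4 : ∀ ω, (X s ω + X t ω) ^ 2 = X s ω ^ 2 + 2 * (X s ω * X t ω) + X t ω ^ 2 := fun ω => by
    ring
  have h5 : Integrable (fun ω => 2 * (X s ω * X t ω)) P :=
    ((hmem s).integrable_mul (hmem t)).const_mul 2
  simp_rw [h4] at h2
  rw [integral_add (f := fun ω => X s ω ^ 2 + 2 * (X s ω * X t ω))
    ((hmem s).integrable_sq.add h5) (hmem t).integrable_sq, integral_add (hmem s).integrable_sq h5,
    integral_const_mul, hsq, hsq, hR t s] at h2
  linarith

end Gaussian

/-! ### Finite-dimensional distributions -/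

section Fdd

variable {Ω Ω' : Type*} [MeasurableSpace Ω] [MeasurableSpace Ω'] {P : Measure Ω} {Q : Measure Ω'}

/-- Convergence of finite-dimensional distributions is convergence of the characteristic functions
of linear combinations (Cramér–Wold). -/
lemma fddTendsto_iff [IsProbabilityMeasure P] [IsProbabilityMeasure Q] {Y : ℝ → ℝ≥0 → Ω → ℝ}
    {Z : ℝ≥0 → Ω' → ℝ} (hY : ∀ T t, AEMeasurable (Y T t) P) :
    FddTendsto Y Z P Q ↔ (∀ t, AEMeasurable (Z t) Q) ∧
      ∀ (n : ℕ) (t : Fin n → ℝ≥0) (a : Fin n → ℝ),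
        Tendsto (fun T => ∫ ω, Complex.exp (((∑ k, a k * Y T (t k) ω : ℝ) : ℂ) * Complex.I) ∂P)
          atTop (𝓝 (∫ ω, Complex.exp (((∑ k, a k * Z (t k) ω : ℝ) : ℂ) * Complex.I) ∂Q)) := by
  constructor
  · intro h
    refine ⟨fun t => ?_, fun n t a => ?_⟩
    · exact (measurable_pi_apply (0 : Fin 1)).comp_aemeasurable (h 1 fun _ => t).aemeasurable_limit
    · obtain ⟨h1, h2, h3⟩ := h n t
      have hc : Continuous fun x : Fin n → ℝ =>
          Complex.exp (((∑ k, a k * x k : ℝ) : ℂ) * Complex.I) := by fun_prop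
      have h4 := (ProbabilityMeasure.tendsto_iff_forall_integral_rclike_tendsto ℂ).1 h3
        (BoundedContinuousFunction.ofNormedAddCommGroup _ hc 1
        fun x => (Complex.norm_exp_ofReal_mul_I _).le)
      simp only [ProbabilityMeasure.coe_mk, BoundedContinuousFunction.coe_ofNormedAddCommGroup]
        at h4
      rw [integral_map h2 hc.aestronglyMeasurable] at h4
      refine h4.congr fun T => ?_
      rw [integral_map (h1 T) hc.aestronglyMeasurable]
  · rintro ⟨hZ, h⟩ n t
    have hYm : ∀ T, AEMeasurable (fun ω (i : Fin n) => Y T (t i) ω) P := fun T =>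
      aemeasurable_pi_lambda _ fun i => hY T (t i)
    have hZm : AEMeasurable (fun ω (i : Fin n) => Z (t i) ω) Q :=
      aemeasurable_pi_lambda _ fun i => hZ (t i)
    -- the continuity theorem for characteristic functions lives on Euclidean space
    have hlp : Measurable (WithLp.toLp 2 : (Fin n → ℝ) → EuclideanSpace ℝ (Fin n)) := by fun_prop
    have hYl : ∀ T, AEMeasurable (fun ω => (WithLp.toLp 2 fun i : Fin n => Y T (t i) ω :
      EuclideanSpace ℝ (Fin n))) P := fun T => hlp.comp_aemeasurable (hYm T)
    have hZl : AEMeasurable (fun ω => (WithLp.toLp 2 fun i : Fin n => Z (t i) ω :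
      EuclideanSpace ℝ (Fin n))) Q := hlp.comp_aemeasurable hZm
    have key : TendstoInDistribution (fun T ω => (WithLp.toLp 2 fun i : Fin n => Y T (t i) ω :
        EuclideanSpace ℝ (Fin n))) atTop (fun ω => (WithLp.toLp 2 fun i : Fin n => Z (t i) ω :
        EuclideanSpace ℝ (Fin n))) (fun _ => P) Q := by
      refine ⟨hYl, hZl, tendsto_of_seq_tendsto fun u hu => ?_⟩
      refine ProbabilityMeasure.tendsto_of_tendsto_charFun fun v => ?_
      have hc : Continuous fun x : EuclideanSpace ℝ (Fin n) =>
          Complex.exp (((inner ℝ x v : ℝ) : ℂ) * Complex.I) := by fun_prop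
      have h2 : ∀ x : Fin n → ℝ, inner ℝ (WithLp.toLp 2 x : EuclideanSpace ℝ (Fin n)) v
          = ∑ k, v k * x k := by
        intro x
        simp [PiLp.inner_apply]
      have hY2 : ∀ T, charFun (P.map fun ω => (WithLp.toLp 2 fun i : Fin n => Y T (t i) ω :
          EuclideanSpace ℝ (Fin n))) v
            = ∫ ω, Complex.exp (((∑ k, v k * Y T (t k) ω : ℝ) : ℂ) * Complex.I) ∂P := by
        intro T
        rw [charFun_apply, integral_map (hYl T) hc.aestronglyMeasurable]
        simp_rw [h2]
      have hZ2 : charFun (Q.map fun ω => (WithLp.toLp 2 fun i : Fin n => Z (t i) ω :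
          EuclideanSpace ℝ (Fin n))) v
            = ∫ ω, Complex.exp (((∑ k, v k * Z (t k) ω : ℝ) : ℂ) * Complex.I) ∂Q := by
        rw [charFun_apply, integral_map hZl hc.aestronglyMeasurable]
        simp_rw [h2]
      have h1 := h n t fun k => v k
      simp_rw [← hY2] at h1
      rw [← hZ2] at h1
      exact h1.comp hu
    exact key.continuous_comp (PiLp.continuous_ofLp 2 fun _ : Fin n => ℝ)

/-- The covariance determines the finite-dimensional distributions of a centered Gaussian
process. -/
lemma IsCenteredGaussian.fddEq {X : ℝ≥0 → Ω → ℝ} {Z : ℝ≥0 → Ω' → ℝ} {R : ℝ≥0 → ℝ≥0 → ℝ}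
    (hX : IsCenteredGaussian X R P) (hZ : IsCenteredGaussian Z R Q) : FddEq X Z P Q := by
  intro n t
  have := hX.gaussian.isProbabilityMeasure
  have := hZ.gaussian.isProbabilityMeasure
  have hXm : AEMeasurable (fun ω (i : Fin n) => X (t i) ω) P :=
    aemeasurable_pi_lambda _ fun i => hX.gaussian.aemeasurable (t i)
  have hZm : AEMeasurable (fun ω (i : Fin n) => Z (t i) ω) Q :=
    aemeasurable_pi_lambda _ fun i => hZ.gaussian.aemeasurable (t i)
  have := Measure.isProbabilityMeasure_map hXm
  have := Measure.isProbabilityMeasure_map hZm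
  refine ⟨hXm, hZm, Measure.ext_of_charFunDual ?_⟩
  ext l
  obtain ⟨a, hl⟩ : ∃ a : Fin n → ℝ, ∀ x : Fin n → ℝ, l x = ∑ k, a k * x k := by
    refine ⟨fun k => l (Pi.single k 1), fun x => ?_⟩
    conv_lhs => rw [← Finset.univ_sum_single x, map_sum]
    refine Finset.sum_congr rfl fun i _ => ?_
    have h2 : Pi.single i (x i) = x i • (Pi.single i (1 : ℝ) : Fin n → ℝ) := by
      rw [← Pi.single_smul]
      simp
    rw [h2, map_smul, smul_eq_mul, mul_comm]
  have hc : Continuous fun x : Fin n → ℝ => Complex.exp ((l x : ℂ) * Complex.I) := by fun_prop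
  rw [charFunDual_apply, charFunDual_apply, integral_map hXm hc.aestronglyMeasurable,
    integral_map hZm hc.aestronglyMeasurable]
  simp_rw [hl]
  rw [hX.integral_cexp, hZ.integral_cexp]

end Fdd

/-! ### The limits of the fluctuations -/

section Limit

variable {α H : ℝ}

lemma Family.re_spectralForm_symm (F : Family) (hα0 : 0 < α) (hα1 : α < 1) (s t : ℝ≥0) :
    (spectralForm α (F.psi t) (F.psi s)).re = (spectralForm α (F.psi s) (F.psi t)).re := by
  have hi := fun s t => (F.isTestFunction_psi s).integrable_spectralIntegrand
    (F.isTestFunction_psi t) hα0 hα1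
  rw [re_spectralForm (hi t s), re_spectralForm (hi s t)]
  congr 2 with x
  rw [spectralIntegrand, spectralIntegrand, Complex.re_mul_ofReal, Complex.re_mul_ofReal]
  simp only [Complex.mul_re, Complex.conj_re, Complex.conj_im]
  ring

/-- The process `K ϑ^H` has the spectral covariance. -/
lemma Family.IsTarget.isCenteredGaussian {F : Family} {Ω : Type*} [MeasurableSpace Ω]
    {P : Measure Ω} {Θ : ℝ≥0 → Ω → ℝ} (h : F.IsTarget H Θ P) {K : ℝ}
    (hK : ∀ s t : ℝ≥0, spectralForm α (F.psi t) (F.psi s) = ((K ^ 2 * F.cov H s t : ℝ) : ℂ)) :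
    IsCenteredGaussian (fun t ω => K * Θ t ω)
      (fun s t => (spectralForm α (F.psi t) (F.psi s)).re) P := by
  refine ⟨h.gaussian.gaussian.smul fun _ => K, fun t => ?_, fun s t => ?_⟩
  · rw [integral_const_mul, h.gaussian.centered, mul_zero]
  · rw [hK, Complex.ofReal_re, ← h.gaussian.covariance, ← integral_const_mul]
    congr 1 with ω
    ring

variable {Ω : Type*} [MeasurableSpace Ω] {P : Measure Ω} [IsProbabilityMeasure P]
  {ξ : ℕ → Ω → ℝ} {L : ℕ → ℝ≥0 → Ω → ℝ}

/-- By linearity, the joint characteristic functions of the fluctuations reduce to that of a single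
test function. -/
lemma IsParticleSystem.tendsto_integral_cexp_sum (h : IsParticleSystem α ξ L P) (hα0 : 0 < α)
    (hα1 : α < 1) (F : Family) {n : ℕ} (t : Fin n → ℝ≥0) (a : Fin n → ℝ) :
    Tendsto (fun T => ∫ ω, Complex.exp
        (((∑ k, a k * fluctuation ξ L P T 1 (F.psi (t k)) ω : ℝ) : ℂ) * Complex.I) ∂P) atTop
      (𝓝 (Complex.exp (-((∑ j, ∑ k, a j * a k *
        (spectralForm α (F.psi (t k)) (F.psi (t j))).re : ℝ) : ℂ) / 2))) := by
  have hψ : ∀ k, IsTestFunction (F.psi (t k)) := fun k => F.isTestFunction_psi (t k)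
  have h1 := h.tendsto_integral_cexp_fluctuation (IsTestFunction.sum_smul a hψ) hα0 hα1
  rw [limitVariance_sum_smul hα0 hα1 a hψ] at h1
  simp_rw [F.re_spectralForm_symm hα0 hα1 (t _) (t _)] at h1 ⊢
  refine h1.congr' ?_
  filter_upwards [eventually_gt_atTop 0] with T hT
  refine integral_congr_ae ?_
  filter_upwards [h.fluctuation_sum_smul a hψ hT] with ω hω
  rw [hω]

/-- The limits of the fluctuations are exactly the centered Gaussian processes with the spectral
covariance. -/
lemma IsParticleSystem.fddTendsto_iff_isCenteredGaussian (h : IsParticleSystem α ξ L P)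
    (hα0 : 0 < α) (hα1 : α < 1) (F : Family) {Ω' : Type*} [MeasurableSpace Ω'] {Q : Measure Ω'}
    [IsProbabilityMeasure Q] (ϑ : ℝ≥0 → Ω' → ℝ) :
    FddTendsto (fun T t => fluctuation ξ L P T 1 (F.psi t)) ϑ P Q ↔
      IsCenteredGaussian ϑ (fun s t => (spectralForm α (F.psi t) (F.psi s)).re) Q := by
  rw [fddTendsto_iff fun T t => h.aemeasurable_fluctuation (F.isTestFunction_psi t) T]
  constructor
  · rintro ⟨hm, hlim⟩
    refine isCenteredGaussian_of_integral_cexp hm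
      (fun s t => F.re_spectralForm_symm hα0 hα1 s t) fun n t a => ?_
    exact tendsto_nhds_unique (hlim n t a) (h.tendsto_integral_cexp_sum hα0 hα1 F t a)
  · intro hϑ
    refine ⟨hϑ.gaussian.aemeasurable, fun n t a => ?_⟩
    rw [hϑ.integral_cexp]
    exact h.tendsto_integral_cexp_sum hα0 hα1 F t a

end Limit

end OccupationLimit

end

theorem corollary2p12 (α : ℝ) (hα0 : 0 < α) (hα1 : α < 1) (F : OccupationLimit.Family) (H : ℝ)
    (hH : H = (1 + α) / 2) :
    (1 / 2 < H ∧ H < 1) ∧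
    ∃ K : ℝ, 0 < K ∧
      -- the covariance of the limit is given by a convergent integral, and it is that of `K ϑ^H`
      (∀ s t : ℝ≥0,
        Integrable (OccupationLimit.spectralIntegrand α (F.psi t) (F.psi s)) ∧
        OccupationLimit.spectralForm α (F.psi t) (F.psi s) = ((K ^ 2 * F.cov H s t : ℝ) : ℂ)) ∧
      -- the limits of the occupation time fluctuations are exactly the centered Gaussian processes
      -- with this covariance, and `K ϑ^H` is such a limit
      (∀ {Ω : Type*} [MeasurableSpace Ω] (P : Measure Ω) [IsProbabilityMeasure P]
        (ξ : ℕ → Ω → ℝ) (L : ℕ → ℝ≥0 → Ω → ℝ), OccupationLimit.IsParticleSystem α ξ L P →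
        ∀ {Ω' : Type*} [MeasurableSpace Ω'] (Q : Measure Ω') [IsProbabilityMeasure Q],
          (∀ ϑ : ℝ≥0 → Ω' → ℝ,
            OccupationLimit.FddTendsto
              (fun T t => OccupationLimit.fluctuation ξ L P T 1 (F.psi t)) ϑ P Q ↔
            OccupationLimit.IsCenteredGaussian ϑ
              (fun s t => (OccupationLimit.spectralForm α (F.psi t) (F.psi s)).re) Q) ∧
          (∀ Θ : ℝ≥0 → Ω' → ℝ, F.IsTarget H Θ Q →
            OccupationLimit.FddTendsto
              (fun T t => OccupationLimit.fluctuation ξ L P T 1 (F.psi t))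
              (fun t ω => K * Θ t ω) P Q)) ∧
      -- every version `ϑ` of the limit is, in law, `K ϑ^H`
      (∀ {Ω : Type*} [MeasurableSpace Ω] (P : Measure Ω) [IsProbabilityMeasure P]
        (ϑ : ℝ≥0 → Ω → ℝ),
        OccupationLimit.IsCenteredGaussian ϑ
          (fun s t => (OccupationLimit.spectralForm α (F.psi t) (F.psi s)).re) P →
        ∀ {Ω' : Type*} [MeasurableSpace Ω'] (Q : Measure Ω') [IsProbabilityMeasure Q]
          (Θ : ℝ≥0 → Ω' → ℝ), F.IsTarget H Θ Q →
          OccupationLimit.FddEq ϑ (fun t ω => K * Θ t ω) P Q) := by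
  have h12 : 1 / 2 < H ∧ H < 1 := by constructor <;> rw [hH] <;> linarith
  obtain ⟨K, hK, hform⟩ := F.exists_spectralForm_eq hα0 hα1 hH
  refine ⟨h12, K, hK, fun s t => ⟨(F.isTestFunction_psi t).integrable_spectralIntegrand
    (F.isTestFunction_psi s) hα0 hα1, hform s t⟩, ?_, ?_⟩
  · intro Ω _ P _ ξ L h Ω' _ Q _
    exact ⟨h.fddTendsto_iff_isCenteredGaussian hα0 hα1 F, fun Θ hΘ =>
      (h.fddTendsto_iff_isCenteredGaussian hα0 hα1 F _).2 (hΘ.isCenteredGaussian hform)⟩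
  · intro Ω _ P _ ϑ hϑ Ω' _ Q _ Θ hΘ
    exact hϑ.fddEq (hΘ.isCenteredGaussian hform)
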